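/- Let $R$ be a ring with unit $1\neq 0$, $M$ a finite left $R$-module with $|M|>1$, $r\in R$ an invertible element, and $I=(i_1,\dots,i_l)\in\mathbb Z^l$ with $l\ge 2$. Put $$\Phi_I(r)=1+\sum_{j=1}^{l'}(-1)^j r^{\,i_1+\cdots+i_j},\qquad l'=l\text{ if }l\text{ is even},\quad l'=l-1\text{ if }l\text{ is odd},$$ and assume $\Phi_I(r)=0$. For $x\in M$ let $s_x:M\to M$ be the bijection $s_x(y)=(1-r)x+ry$, let $\eta_I(x,y,z)=\bigl(s_x^{i_1}s_y^{i_2}s_x^{i_3}\cdots\bigr)(z)$ (with $l$ factors, alternating between powers of $s_x$ and $s_y$), and let $\mu(a,b,c)=\eta_I(b,a,c)$. Let $Q$ be a quasigroup (a nonempty set with a binary operation all of whose left and right translations are bijective; $u\backslash w$ denotes the unique $v$ with $uv=w$), and let $\pi:Q\to M$ be a bijection. For $\lambda\in Q$ define $\sigma(\lambda):Q\times Q\to Q\times Q$ by $$\sigma(\lambda)(u,v)=\bigl(h\backslash((\lambda v)u),\ \lambda\backslash h\bigr),\qquad h=\pi^{-1}\bigl(\mu(\pi(\lambda),\pi(\lambda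 v),\pi((\lambda v)u))\bigr).$$ Let $K$ be any field and $M_Q$ the $K$-algebra of all maps $Q\to K$. For $a\in Q$ and $f\in M_Q$ put $T_a(f)(\lambda)=f(\lambda a)$, and let $\sigma^{xy}_{ac}\in M_Q$ be the function with $\sigma^{xy}_{ac}(\lambda)=1$ if $\sigma(\lambda)(x,y)=(a,c)$ and $0$ otherwise. Let $A_\sigma$ be the $K$-algebra generated by the elements of $M_Q\otimes_K M_Q$ and symbols $L_{ab}$, $(L^{-1})_{ab}$ $(a,b\in Q)$, subject to the following relations, for all $f\in M_Q$ and $a,b,c,d\in Q$: 1. sums, scalar multiples, products and the unit of $M_Q\otimes_K M_Q$ agree with those of $A_\sigma$; 2. $\sum_{c}L_{ac}(L^{-1})_{cb}=\delta_{ab}1=\sum_{c}(L^{-1})_{ac}L_{cb}$; 3. $(T_a(f)\otimes1)L_{ab}=L_{ab}(f\otimes1)$, $\ (1\otimes T_b(f))L_{ab}=L_{ab}(1\otimes f)$, $\ (f\otimes 1)(L^{-1})_{ab}=(L^{-1})_{ab}(T_b(f)\otimes1)$, $\ (1\otimes f)(L^{-1})_{ab}=(L^{-1})_{ab}(1\otimes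 T_a(f))$; 4. $\sum_{x,y}(\sigma^{xy}_{ac}\otimes1)L_{yd}L_{xb}=\sum_{x,y}(1\otimes\sigma^{bd}_{xy})L_{cy}L_{ax}$. Then $A_\sigma$ is a Hopf algebroid over $M_Q$ in the sense of Böhm. That is, $A_\sigma$ carries a left bialgebroid structure $(s_L,t_L,\gamma_L,\pi_L)$ and a right bialgebroid structure $(s_R,t_R,\gamma_R,\pi_R)$, both with base algebra $M_Q$, and a $K$-linear map $S:A_\sigma\to A_\sigma$ such that - $s_L\pi_Lt_R=t_R$, $\ t_L\pi_Ls_R=s_R$, $\ s_R\pi_Rt_L=t_L$, $\ t_R\pi_Rs_L=s_L$; - $(\gamma_L\otimes\mathrm{id})\gamma_R=(\mathrm{id}\otimes\gamma_R)\gamma_L$ and $(\gamma_R\otimes\mathrm{id})\gamma_L=(\mathrm{id}\otimes\gamma_L)\gamma_R$; - $S(t_L(f)\,a\,t_R(g))=s_R(g)\,S(a)\,s_L(f)$ for $f,g\in M_Q$ and $a\in A_\sigma$; - $m(S\otimes\mathrm{id})\gamma_L=s_R\pi_R$ and $m(\mathrm{id}\otimes S)\gamma_R=s_L\pi_L$,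 where $m$ is the multiplication. The structure maps are given on generators by $s_L(f)=t_R(f)=f\otimes1$, $t_L(f)=s_R(f)=1\otimes f$, $\gamma_L(L_{ab})=\sum_cL_{ac}\otimes L_{cb}$ and $\gamma_R(L_{ab})=\sum_cL_{ac}\otimes L_{cb}$ (in the respective balanced tensor products), $\pi_L(L_{ab})=\pi_R(L_{ab})=\delta_{ab}1$, and $S(L_{ab})=(L^{-1})_{ab}$. Moreover, the antipode $S$ is bijective. -/

import Mathlib

open scoped TensorProduct

noncomputable section

namespace SSetHopf

/-! ## Balanced tensor products -/

section Balanced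

variable {k A B B₁ B₂ : Type*} [CommRing k] [Ring A] [Algebra k A]

/-- The submodule of `A ⊗[k] A` spanned by the elements `x·b ⊗ y - x ⊗ b·y`, where `B` acts on the
first factor through `ρ` and on the second factor through `τ`. -/
def balanced (ρ τ : B → A →ₗ[k] A) : Submodule k (A ⊗[k] A) :=
  Submodule.span k {z | ∃ b x y, z = ρ b x ⊗ₜ[k] y - x ⊗ₜ[k] τ b y}

/-- The tensor product `A ⊗_B A`. -/
abbrev BalTensor (ρ τ : B → A →ₗ[k] A) : Type _ := (A ⊗[k] A) ⧸ balanced ρ τ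

/-- The submodule of `A ⊗[k] (A ⊗[k] A)` that is divided out to form `A ⊗_{B₁} A ⊗_{B₂} A`. -/
def balanced₃ (ρ₁ τ₁ : B₁ → A →ₗ[k] A) (ρ₂ τ₂ : B₂ → A →ₗ[k] A) :
    Submodule k (A ⊗[k] (A ⊗[k] A)) :=
  Submodule.span k
    ({w | ∃ b x y z, w = ρ₁ b x ⊗ₜ[k] (y ⊗ₜ[k] z) - x ⊗ₜ[k] (τ₁ b y ⊗ₜ[k] z)} ∪
     {w | ∃ b x y z, w = x ⊗ₜ[k] (ρ₂ b y ⊗ₜ[k] z) - x ⊗ₜ[k] (y ⊗ₜ[k] τ₂ b z)})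

/-- The tensor product `A ⊗_{B₁} A ⊗_{B₂} A`. -/
abbrev BalTensor₃ (ρ₁ τ₁ : B₁ → A →ₗ[k] A) (ρ₂ τ₂ : B₂ → A →ₗ[k] A) : Type _ :=
  (A ⊗[k] (A ⊗[k] A)) ⧸ balanced₃ ρ₁ τ₁ ρ₂ τ₂

/-- The canonical map `(A ⊗_{B₁} A) ⊗_k A → A ⊗_{B₁} A ⊗_{B₂} A`. -/
def glueLeft (ρ₁ τ₁ : B₁ → A →ₗ[k] A) (ρ₂ τ₂ : B₂ → A →ₗ[k] A) :
    BalTensor ρ₁ τ₁ ⊗[k] A →ₗ[k] BalTensor₃ ρ₁ τ₁ ρ₂ τ₂ :=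
  TensorProduct.lift <| Submodule.liftQ _
    (TensorProduct.curry
      ((balanced₃ ρ₁ τ₁ ρ₂ τ₂).mkQ ∘ₗ (TensorProduct.assoc k A A A).toLinearMap)) <| by
    refine Submodule.span_le.2 ?_
    rintro _ ⟨b, x, y, rfl⟩
    refine LinearMap.mem_ker.2 (LinearMap.ext fun z => ?_)
    rw [map_sub, LinearMap.sub_apply, LinearMap.zero_apply, sub_eq_zero]
    exact (Submodule.Quotient.eq _).2 (Submodule.subset_span (Or.inl ⟨b, x, y, z, rfl⟩))

/-- The canonical map `A ⊗_k (A ⊗_{B₂} A) → A ⊗_{B₁} A ⊗_{B₂} A`. -/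
def glueRight (ρ₁ τ₁ : B₁ → A →ₗ[k] A) (ρ₂ τ₂ : B₂ → A →ₗ[k] A) :
    A ⊗[k] BalTensor ρ₂ τ₂ →ₗ[k] BalTensor₃ ρ₁ τ₁ ρ₂ τ₂ :=
  TensorProduct.lift <| LinearMap.flip <| Submodule.liftQ _
    (LinearMap.flip (TensorProduct.mk k A (A ⊗[k] A)) |>.compr₂ (balanced₃ ρ₁ τ₁ ρ₂ τ₂).mkQ) <| by
    refine Submodule.span_le.2 ?_
    rintro _ ⟨b, y, z, rfl⟩
    refine LinearMap.mem_ker.2 (LinearMap.ext fun x => ?_)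
    rw [map_sub, LinearMap.sub_apply, LinearMap.zero_apply, sub_eq_zero]
    exact (Submodule.Quotient.eq _).2 (Submodule.subset_span (Or.inr ⟨b, x, y, z, rfl⟩))

end Balanced

/-! ## Bialgebroids and Hopf algebroids

In the axioms below, a hypothesis `Submodule.Quotient.mk x = comul a` says that `x ∈ A ⊗_k A` is a
representative `∑ a₍₁₎ ⊗ a₍₂₎` of the coproduct of `a`. Axioms in Sweedler notation are stated for
every representative: by the remaining axioms the maps involved factor through the balanced tensor
products, so the expressions do not depend on the choice of the representative. -/

section Bialgebroid

variable (k A : Type*) [CommRing k] [Ring A] [Algebra k A]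

/-- A left bialgebroid over the (possibly noncommutative) `k`-algebra `L` with total algebra `A`.
The `L`-bimodule structure of `A` is `l · a · l' = s(l) t(l') a`. -/
structure LeftBialgebroid (L : Type*) [Ring L] [Algebra k L] where
  source : L →ₐ[k] A
  target : Lᵐᵒᵖ →ₐ[k] A
  source_target_comm : ∀ l l', source l * target l' = target l' * source l
  /-- The coproduct `A → A ⊗_L A`. -/
  comul : A →ₗ[k] BalTensor (k := k) (A := A)
    (fun l : L => LinearMap.mulLeft k (target (MulOpposite.op l)))
    (fun l : L => LinearMap.mulLeft k (source l))
  counit : A →ₗ[k] L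
  comul_bimodule : ∀ l l' a x, Submodule.Quotient.mk x = comul a →
    comul (source l * target (MulOpposite.op l') * a) =
      Submodule.Quotient.mk ((source l ⊗ₜ[k] target (MulOpposite.op l')) * x)
  counit_bimodule : ∀ l l' a,
    counit (source l * target (MulOpposite.op l') * a) = l * counit a * l'
  coassoc : ∀ a x y, Submodule.Quotient.mk x = comul a → Submodule.Quotient.mk y = comul a →
    glueLeft _ _ (fun l : L => LinearMap.mulLeft k (target (MulOpposite.op l)))
        (fun l : L => LinearMap.mulLeft k (source l)) (comul.rTensor A x) =
      glueRight _ _ _ _ (comul.lTensor A y)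
  /-- `s(π(a₍₁₎)) a₍₂₎ = a` -/
  counit_comul : ∀ a x, Submodule.Quotient.mk x = comul a →
    LinearMap.mul' k A
      (TensorProduct.map (source.toLinearMap ∘ₗ counit) LinearMap.id x) = a
  /-- `t(π(a₍₂₎)) a₍₁₎ = a` -/
  comul_counit : ∀ a x, Submodule.Quotient.mk x = comul a →
    LinearMap.mul' k A
      (TensorProduct.map
        (target.toLinearMap ∘ₗ (MulOpposite.opLinearEquiv k).toLinearMap ∘ₗ counit)
        LinearMap.id (TensorProduct.comm k A A x)) = a
  /-- `a₍₁₎ t(l) ⊗ a₍₂₎ = a₍₁₎ ⊗ a₍₂₎ s(l)` -/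
  takeuchi : ∀ l a x, Submodule.Quotient.mk x = comul a →
    (Submodule.Quotient.mk (x * (target (MulOpposite.op l) ⊗ₜ[k] 1)) :
        BalTensor (k := k) (A := A)
          (fun l : L => LinearMap.mulLeft k (target (MulOpposite.op l)))
          (fun l : L => LinearMap.mulLeft k (source l))) =
      Submodule.Quotient.mk (x * (1 ⊗ₜ[k] source l))
  comul_one : comul 1 = Submodule.Quotient.mk (1 ⊗ₜ[k] 1)
  comul_mul : ∀ a b x y, Submodule.Quotient.mk x = comul a → Submodule.Quotient.mk y = comul b →
    comul (a * b) = Submodule.Quotient.mk (x * y)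
  counit_one : counit 1 = 1
  counit_mul_source : ∀ a b, counit (a * source (counit b)) = counit (a * b)
  counit_mul_target : ∀ a b, counit (a * target (MulOpposite.op (counit b))) = counit (a * b)

/-- A right bialgebroid over the (possibly noncommutative) `k`-algebra `N` with total algebra `A`.
The `N`-bimodule structure of `A` is `n · a · n' = a s(n') t(n)`. -/
structure RightBialgebroid (N : Type*) [Ring N] [Algebra k N] where
  source : N →ₐ[k] A
  target : Nᵐᵒᵖ →ₐ[k] A
  source_target_comm : ∀ n n', source n * target n' = target n' * source n
  /-- The coproduct `A → A ⊗_N A`. -/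
  comul : A →ₗ[k] BalTensor (k := k) (A := A)
    (fun n : N => LinearMap.mulRight k (source n))
    (fun n : N => LinearMap.mulRight k (target (MulOpposite.op n)))
  counit : A →ₗ[k] N
  comul_bimodule : ∀ n n' a x, Submodule.Quotient.mk x = comul a →
    comul (a * source n' * target (MulOpposite.op n)) =
      Submodule.Quotient.mk (x * (target (MulOpposite.op n) ⊗ₜ[k] source n'))
  counit_bimodule : ∀ n n' a,
    counit (a * source n' * target (MulOpposite.op n)) = n * counit a * n'
  coassoc : ∀ a x y, Submodule.Quotient.mk x = comul a → Submodule.Quotient.mk y = comul a →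
    glueLeft _ _ (fun n : N => LinearMap.mulRight k (source n))
        (fun n : N => LinearMap.mulRight k (target (MulOpposite.op n))) (comul.rTensor A x) =
      glueRight _ _ _ _ (comul.lTensor A y)
  /-- `a⁽¹⁾ s(π(a⁽²⁾)) = a` -/
  comul_counit : ∀ a x, Submodule.Quotient.mk x = comul a →
    LinearMap.mul' k A
      (TensorProduct.map LinearMap.id (source.toLinearMap ∘ₗ counit) x) = a
  /-- `a⁽²⁾ t(π(a⁽¹⁾)) = a` -/
  counit_comul : ∀ a x, Submodule.Quotient.mk x = comul a →
    LinearMap.mul' k A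
      (TensorProduct.map LinearMap.id
        (target.toLinearMap ∘ₗ (MulOpposite.opLinearEquiv k).toLinearMap ∘ₗ counit)
        (TensorProduct.comm k A A x)) = a
  /-- `s(n) a⁽¹⁾ ⊗ a⁽²⁾ = a⁽¹⁾ ⊗ t(n) a⁽²⁾` -/
  takeuchi : ∀ n a x, Submodule.Quotient.mk x = comul a →
    (Submodule.Quotient.mk ((source n ⊗ₜ[k] 1) * x) :
        BalTensor (k := k) (A := A)
          (fun n : N => LinearMap.mulRight k (source n))
          (fun n : N => LinearMap.mulRight k (target (MulOpposite.op n)))) =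
      Submodule.Quotient.mk ((1 ⊗ₜ[k] target (MulOpposite.op n)) * x)
  comul_one : comul 1 = Submodule.Quotient.mk (1 ⊗ₜ[k] 1)
  comul_mul : ∀ a b x y, Submodule.Quotient.mk x = comul a → Submodule.Quotient.mk y = comul b →
    comul (a * b) = Submodule.Quotient.mk (x * y)
  counit_one : counit 1 = 1
  counit_source_mul : ∀ a b, counit (source (counit a) * b) = counit (a * b)
  counit_target_mul : ∀ a b, counit (target (MulOpposite.op (counit a)) * b) = counit (a * b)

/-- A Hopf algebroid in the sense of Böhm: a left bialgebroid over `L` and a right bialgebroid over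
`N` with the same total algebra `A`, together with an antipode. -/
structure HopfAlgebroid (L N : Type*) [Ring L] [Algebra k L] [Ring N] [Algebra k N] where
  left : LeftBialgebroid k A L
  right : RightBialgebroid k A N
  antipode : A →ₗ[k] A
  sL_pL_tR : ∀ n, left.source (left.counit (right.target n)) = right.target n
  tL_pL_sR : ∀ n, left.target (MulOpposite.op (left.counit (right.source n))) = right.source n
  sR_pR_tL : ∀ l, right.source (right.counit (left.target l)) = left.target l
  tR_pR_sL : ∀ l, right.target (MulOpposite.op (right.counit (left.source l))) = left.source l
  /-- `(γ_L ⊗_N A) γ_R = (A ⊗_L γ_R) γ_L` -/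
  mixed_coassoc_LR : ∀ a x y,
    Submodule.Quotient.mk x = right.comul a → Submodule.Quotient.mk y = left.comul a →
    glueLeft _ _ (fun n : N => LinearMap.mulRight k (right.source n))
        (fun n : N => LinearMap.mulRight k (right.target (MulOpposite.op n)))
        (left.comul.rTensor A x) =
      glueRight _ _ _ _ (right.comul.lTensor A y)
  /-- `(γ_R ⊗_L A) γ_L = (A ⊗_N γ_L) γ_R` -/
  mixed_coassoc_RL : ∀ a x y,
    Submodule.Quotient.mk x = left.comul a → Submodule.Quotient.mk y = right.comul a →
    glueLeft _ _ (fun l : L => LinearMap.mulLeft k (left.target (MulOpposite.op l)))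
        (fun l : L => LinearMap.mulLeft k (left.source l))
        (right.comul.rTensor A x) =
      glueRight _ _ _ _ (left.comul.lTensor A y)
  antipode_bimodule : ∀ l n a,
    antipode (left.target (MulOpposite.op l) * a * right.target (MulOpposite.op n)) =
      right.source n * antipode a * left.source l
  /-- `S(a₍₁₎) a₍₂₎ = s_R(π_R(a))` -/
  antipode_left : ∀ a x, Submodule.Quotient.mk x = left.comul a →
    LinearMap.mul' k A (TensorProduct.map antipode LinearMap.id x) = right.source (right.counit a)
  /-- `a⁽¹⁾ S(a⁽²⁾) = s_L(π_L(a))` -/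
  antipode_right : ∀ a x, Submodule.Quotient.mk x = right.comul a →
    LinearMap.mul' k A (TensorProduct.map LinearMap.id antipode x) = left.source (left.counit a)

end Bialgebroid

/-! ## Quasigroups -/

/-- A nonempty set whose left and right translations are all bijective. -/
class IsQuasigroup (Q : Type*) [Mul Q] : Prop where
  nonempty : Nonempty Q
  existsUnique_mul_left : ∀ u w : Q, ∃! v, u * v = w
  existsUnique_mul_right : ∀ v w : Q, ∃! u, u * v = w

/-- `u \ w`, the unique `v` with `u v = w`. -/
def ldiv {Q : Type*} [Mul Q] [IsQuasigroup Q] (u w : Q) : Q :=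
  (IsQuasigroup.existsUnique_mul_left u w).choose

/-! ## The s-set of a module and its ternary operations -/

/-- The word `w_I(X, Y) = X^{i₁} Y^{i₂} X^{i₃} ⋯` evaluated in a group. -/
def word {G : Type*} [Group G] : List ℤ → G → G → G
  | [], _, _ => 1
  | i :: I, X, Y => X ^ i * word I Y X

section Module

variable {R M : Type*} [Ring R] [AddCommGroup M] [Module R M]

/-- The bijection `s_x(y) = (1 - r) x + r y`. -/
def sPerm (r : Rˣ) (x : M) : Equiv.Perm M where
  toFun y := (1 - (r : R)) • x + (r : R) • y
  invFun y := (1 - ((r⁻¹ : Rˣ) : R)) • x + ((r⁻¹ : Rˣ) : R) • y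
  left_inv y := by
    simp only [smul_add, smul_smul, sub_smul, smul_sub, one_smul, Units.inv_mul]; abel
  right_inv y := by
    simp only [smul_add, smul_smul, sub_smul, smul_sub, one_smul, Units.mul_inv]; abel

/-- `η_I(x, y, z) = w_I(s_x, s_y)(z)`. -/
def eta (r : Rˣ) (I : List ℤ) (x y z : M) : M := word I (sPerm r x) (sPerm r y) z

/-- `μ(a, b, c) = η_I(b, a, c)`. -/
def mu (r : Rˣ) (I : List ℤ) (a b c : M) : M := eta r I b a c

/-- `Φ_I(r) = 1 + ∑_j (-1)^j r^{i₁ + ⋯ + i_j}`, where `j` runs from `1` to the largest even number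
that is at most the length of `I`. -/
def phi (I : List ℤ) (r : Rˣ) : R :=
  1 + ∑ j ∈ Finset.Icc 1 (if Even I.length then I.length else I.length - 1),
    (-1) ^ j * ((r ^ (I.take j).sum : Rˣ) : R)

end Module

/-- The map `σ(l)(u, v) = (h \ ((l v) u), l \ h)` with
`h = π⁻¹(m(π(l), π(l v), π((l v) u)))` for a ternary operation `m` on `S`. -/
def sigma {Q S : Type*} [Mul Q] [IsQuasigroup Q] (π : Q ≃ S) (m : S → S → S → S)
    (l : Q) (p : Q × Q) : Q × Q :=
  let h : Q := π.symm (m (π l) (π (l * p.2)) (π ((l * p.2) * p.1)))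
  (ldiv h ((l * p.2) * p.1), ldiv l h)

/-! ## The algebra `A_σ` -/

section FRT

/-- The generating set `(M_Q ⊗ M_Q) ⊔ {L_{ab}} ⊔ {(L⁻¹)_{ab}}`, where `M_Q = Q → K`. -/
inductive FRTGen (K Q : Type*) [Field K] where
  | coeff (ξ : (Q → K) ⊗[K] (Q → K))
  | L (a b : Q)
  | Linv (a b : Q)

variable (K : Type*) [Field K] {Q : Type*}

open Classical in
/-- Kronecker's delta. -/
def delta (a b : Q) : K := if a = b then 1 else 0

variable {K} in
/-- `T_a(f)(l) = f(l a)`. -/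
def shift [Mul Q] (a : Q) (f : Q → K) : Q → K := fun l => f (l * a)

open Classical in
/-- `sigmaCoeff K σ x y a c` is the function `σ^{xy}_{ac}`. -/
def sigmaCoeff (σ : Q → Q × Q → Q × Q) (x y a c : Q) : Q → K :=
  fun l => if σ l (x, y) = (a, c) then 1 else 0

/-- The free algebra on the generating set. -/
abbrev FRTFree (K Q : Type*) [Field K] : Type _ := FreeAlgebra K (FRTGen K Q)

/-- An element of `M_Q ⊗ M_Q` as a generator of the free algebra. -/
def fC (ξ : (Q → K) ⊗[K] (Q → K)) : FRTFree K Q := FreeAlgebra.ι K (FRTGen.coeff ξ)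

/-- The generator `L_{ab}` of the free algebra. -/
def fL (a b : Q) : FRTFree K Q := FreeAlgebra.ι K (FRTGen.L a b)

/-- The generator `(L⁻¹)_{ab}` of the free algebra. -/
def fLinv (a b : Q) : FRTFree K Q := FreeAlgebra.ι K (FRTGen.Linv a b)

/-- The defining relations of `A_σ`. -/
inductive FRTRel [Mul Q] [Fintype Q] (σ : Q → Q × Q → Q × Q) :
    FRTFree K Q → FRTFree K Q → Prop
  | add (ξ ξ' : (Q → K) ⊗[K] (Q → K)) : FRTRel σ (fC K ξ + fC K ξ') (fC K (ξ + ξ'))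
  | smul (c : K) (ξ : (Q → K) ⊗[K] (Q → K)) : FRTRel σ (c • fC K ξ) (fC K (c • ξ))
  | mul (ξ ξ' : (Q → K) ⊗[K] (Q → K)) : FRTRel σ (fC K ξ * fC K ξ') (fC K (ξ * ξ'))
  | L_Linv (a b : Q) : FRTRel σ (∑ c, fL K a c * fLinv K c b) (delta K a b • 1)
  | Linv_L (a b : Q) : FRTRel σ (∑ c, fLinv K a c * fL K c b) (delta K a b • 1)
  | left_L (f : Q → K) (a b : Q) :
      FRTRel σ (fC K (shift a f ⊗ₜ 1) * fL K a b) (fL K a b * fC K (f ⊗ₜ 1))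
  | right_L (f : Q → K) (a b : Q) :
      FRTRel σ (fC K (1 ⊗ₜ shift b f) * fL K a b) (fL K a b * fC K (1 ⊗ₜ f))
  | left_Linv (f : Q → K) (a b : Q) :
      FRTRel σ (fC K (f ⊗ₜ 1) * fLinv K a b) (fLinv K a b * fC K (shift b f ⊗ₜ 1))
  | right_Linv (f : Q → K) (a b : Q) :
      FRTRel σ (fC K (1 ⊗ₜ f) * fLinv K a b) (fLinv K a b * fC K (1 ⊗ₜ shift a f))
  | rll (a b c d : Q) :
      FRTRel σ
        (∑ x, ∑ y, fC K (sigmaCoeff K σ x y a c ⊗ₜ 1) * fL K y d * fL K x b)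
        (∑ x, ∑ y, fC K (1 ⊗ₜ sigmaCoeff K σ b d x y) * fL K c y * fL K a x)
  | one : FRTRel σ 1 (fC K (1 ⊗ₜ 1))

/-- The algebra `A_σ`: the quotient of the free algebra by the two-sided ideal generated by the
differences of the two sides of the relations. -/
abbrev FRTAlgebra [Mul Q] [Fintype Q] (σ : Q → Q × Q → Q × Q) : Type _ := RingQuot (FRTRel K σ)

variable [Mul Q] [Fintype Q] (σ : Q → Q × Q → Q × Q)

/-- The class of `ξ ∈ M_Q ⊗ M_Q` in `A_σ`. -/
def aC (ξ : (Q → K) ⊗[K] (Q → K)) : FRTAlgebra K σ := RingQuot.mkAlgHom K _ (fC K ξ)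

/-- The class of `L_{ab}` in `A_σ`. -/
def aL (a b : Q) : FRTAlgebra K σ := RingQuot.mkAlgHom K _ (fL K a b)

/-- The class of `(L⁻¹)_{ab}` in `A_σ`. -/
def aLinv (a b : Q) : FRTAlgebra K σ := RingQuot.mkAlgHom K _ (fLinv K a b)

/-- The structure maps of a Hopf algebroid on `A_σ` over `M_Q` and `M_Q` take the FRT form on the
generators. -/
structure IsFRTStructure (H : HopfAlgebroid K (FRTAlgebra K σ) (Q → K) (Q → K)) : Prop where
  left_source : ∀ f, H.left.source f = aC K σ (f ⊗ₜ 1)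
  left_target : ∀ f, H.left.target (MulOpposite.op f) = aC K σ (1 ⊗ₜ f)
  right_source : ∀ f, H.right.source f = aC K σ (1 ⊗ₜ f)
  right_target : ∀ f, H.right.target (MulOpposite.op f) = aC K σ (f ⊗ₜ 1)
  left_comul : ∀ a b,
    H.left.comul (aL K σ a b) = Submodule.Quotient.mk (∑ c, aL K σ a c ⊗ₜ[K] aL K σ c b)
  right_comul : ∀ a b,
    H.right.comul (aL K σ a b) = Submodule.Quotient.mk (∑ c, aL K σ a c ⊗ₜ[K] aL K σ c b)
  left_counit : ∀ a b, H.left.counit (aL K σ a b) = fun _ => delta K a b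
  right_counit : ∀ a b, H.right.counit (aL K σ a b) = fun _ => delta K a b
  antipode_L : ∀ a b, H.antipode (aL K σ a b) = aLinv K σ a b

end FRT

end SSetHopf

end

open scoped TensorProduct

noncomputable section

namespace SSetHopf

/-! Since `Q` is finite, `M_Q = K^Q` is split semisimple, and E = ∑_l t(e_l) ⊗ s(e_l) (`sepIdem`) is
a separability idempotent: multiplying by it does not change a class in the balanced tensor product.
The coproduct can therefore be an honest map A → A ⊗_K A that is multiplicative with Δ(1) = E. This
makes A = A_σ a weak Hopf algebra (`WeakHopfData`), and every such structure yields a Hopf algebroid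
(`WeakHopfData.hopfAlgebroid`). Left and right coproducts are the classes of the same Δ.

The coproduct comes from the universal property of A, with target the corner E(A ⊗ A)E, whose unit
is E. The counits come from a representation of A on `M_Q`: functions act by multiplication through
both s and t, and L_{ab} acts by δ_{ab} T_a. The exchange relation holds there because σ(l)(x,y) =
(a,c) forces (lc)a = (ly)x. The left counit applies an element to the constant function 1, the right
counit applies 1 to it as a row vector.

The antipode is the anti-homomorphism exchanging s with t and L with L⁻¹, and it is an involution.
The work lies in checking the defining relations in the opposite algebra; in particular ∑_c
L_{cb}(L⁻¹)_{ac} = δ_{ab} must be derived. This is where Φ_I(r) = 0 enters: then μ(a,b,c) = a + ρ(c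
- b) with ρ = r^{i₁+⋯+i_l} a unit (`mu_eq`), so that any three corners of a face (a,b,c,μ(a,b,c))
determine the remaining one (`isFaceModel_sigma`). Cutting L by the idempotents e_a ⊗ e_{a'} gives
components indexed by pairs of edges. The exchange relation becomes an equality of two paths around
a pair of faces (`edgeL_face`), and inserting L⁻¹L and LL⁻¹ moves inverses across faces
(`edgeL_mul_edgeLinv`, `edgeLinv_face`). Degenerate faces then give the reversed inverse relations.
-/

set_option linter.unusedSectionVars false

/-! ### Coproducts on representatives in balanced tensor products -/

section Representatives

variable {k A B B₁ B₂ V : Type*} [CommRing k] [Ring A] [Algebra k A] [AddCommGroup V] [Module k V]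

lemma BalTensor.mk_eq_mk (ρ τ : B → A →ₗ[k] A) (b : B) (x y : A) :
    (Submodule.Quotient.mk (ρ b x ⊗ₜ[k] y) : BalTensor ρ τ) =
      Submodule.Quotient.mk (x ⊗ₜ[k] τ b y) :=
  (Submodule.Quotient.eq _).2 (Submodule.subset_span ⟨b, x, y, rfl⟩)

/-- A linear map that is balanced on pure tensors takes the same value on all representatives. -/
lemma BalTensor.apply_eq_of_mk_eq {ρ τ : B → A →ₗ[k] A} (F : A ⊗[k] A →ₗ[k] V)
    (hF : ∀ b x y, F (ρ b x ⊗ₜ y) = F (x ⊗ₜ τ b y)) {x y : A ⊗[k] A}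
    (h : (Submodule.Quotient.mk x : BalTensor ρ τ) = Submodule.Quotient.mk y) : F x = F y := by
  have hle : balanced ρ τ ≤ LinearMap.ker F := by
    refine Submodule.span_le.2 ?_
    rintro _ ⟨b, x, y, rfl⟩
    simp [hF]
  have := hle ((Submodule.Quotient.eq _).1 h)
  rwa [LinearMap.mem_ker, map_sub, sub_eq_zero] at this

lemma glueLeft_rTensor_mk (ρ₁ τ₁ : B₁ → A →ₗ[k] A) (ρ₂ τ₂ : B₂ → A →ₗ[k] A)
    (Δ : A →ₗ[k] A ⊗[k] A) (x : A ⊗[k] A) :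
    glueLeft ρ₁ τ₁ ρ₂ τ₂ (((balanced ρ₁ τ₁).mkQ ∘ₗ Δ).rTensor A x) =
      Submodule.Quotient.mk (TensorProduct.assoc k A A A (Δ.rTensor A x)) := by
  induction x with
  | zero => simp
  | add x y hx hy => simp only [map_add, hx, hy, Submodule.Quotient.mk_add]
  | tmul x y => rfl

lemma glueRight_lTensor_mk (ρ₁ τ₁ : B₁ → A →ₗ[k] A) (ρ₂ τ₂ : B₂ → A →ₗ[k] A)
    (Δ : A →ₗ[k] A ⊗[k] A) (x : A ⊗[k] A) :
    glueRight ρ₁ τ₁ ρ₂ τ₂ (((balanced ρ₂ τ₂).mkQ ∘ₗ Δ).lTensor A x) =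
      Submodule.Quotient.mk (Δ.lTensor A x) := by
  induction x with
  | zero => simp
  | add x y hx hy => simp only [map_add, hx, hy, Submodule.Quotient.mk_add]
  | tmul x y => rfl

lemma mk_assoc_tmul_eq (ρ₁ τ₁ : B₁ → A →ₗ[k] A) (ρ₂ τ₂ : B₂ → A →ₗ[k] A) (b : B₂)
    (w : A ⊗[k] A) (z : A) :
    (Submodule.Quotient.mk (TensorProduct.assoc k A A A ((ρ₂ b).lTensor A w ⊗ₜ[k] z)) :
        BalTensor₃ ρ₁ τ₁ ρ₂ τ₂) =
      Submodule.Quotient.mk (TensorProduct.assoc k A A A (w ⊗ₜ[k] τ₂ b z)) := by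
  induction w with
  | zero => simp
  | add x y hx hy => simp only [map_add, TensorProduct.add_tmul, Submodule.Quotient.mk_add, hx, hy]
  | tmul x y =>
    exact (Submodule.Quotient.eq _).2 (Submodule.subset_span (Or.inr ⟨b, x, y, z, rfl⟩))

lemma mk_tmul_eq (ρ₁ τ₁ : B₁ → A →ₗ[k] A) (ρ₂ τ₂ : B₂ → A →ₗ[k] A) (b : B₁)
    (w : A ⊗[k] A) (x : A) :
    (Submodule.Quotient.mk (ρ₁ b x ⊗ₜ[k] w) : BalTensor₃ ρ₁ τ₁ ρ₂ τ₂) =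
      Submodule.Quotient.mk (x ⊗ₜ[k] (τ₁ b).rTensor A w) := by
  induction w with
  | zero => simp
  | add x y hx hy => simp only [map_add, TensorProduct.tmul_add, Submodule.Quotient.mk_add, hx, hy]
  | tmul y z =>
    exact (Submodule.Quotient.eq _).2 (Submodule.subset_span (Or.inl ⟨b, x, y, z, rfl⟩))

/-- A coassociative map `A → A ⊗_k A` is coassociative over every pair of bases over which
it is suitably linear, for all representatives. -/
lemma glue_coassoc (ρ₁ τ₁ : B₁ → A →ₗ[k] A) (ρ₂ τ₂ : B₂ → A →ₗ[k] A)
    (Δ : A →ₗ[k] A ⊗[k] A)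
    (hΔ : ∀ a, TensorProduct.assoc k A A A (Δ.rTensor A (Δ a)) = Δ.lTensor A (Δ a))
    (h₂ : ∀ b a, Δ (ρ₂ b a) = (ρ₂ b).lTensor A (Δ a))
    (h₁ : ∀ b a, Δ (τ₁ b a) = (τ₁ b).rTensor A (Δ a)) (a : A) (x y : A ⊗[k] A)
    (hx : (Submodule.Quotient.mk x : BalTensor ρ₂ τ₂) = Submodule.Quotient.mk (Δ a))
    (hy : (Submodule.Quotient.mk y : BalTensor ρ₁ τ₁) = Submodule.Quotient.mk (Δ a)) :
    glueLeft ρ₁ τ₁ ρ₂ τ₂ (((balanced ρ₁ τ₁).mkQ ∘ₗ Δ).rTensor A x) =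
      glueRight ρ₁ τ₁ ρ₂ τ₂ (((balanced ρ₂ τ₂).mkQ ∘ₗ Δ).lTensor A y) := by
  rw [glueLeft_rTensor_mk, glueRight_lTensor_mk]
  have e₁ := BalTensor.apply_eq_of_mk_eq ((balanced₃ ρ₁ τ₁ ρ₂ τ₂).mkQ ∘ₗ
      (TensorProduct.assoc k A A A).toLinearMap ∘ₗ Δ.rTensor A) (fun b x y => by
    simpa [h₂] using mk_assoc_tmul_eq ρ₁ τ₁ ρ₂ τ₂ b (Δ x) y) hx
  have e₂ := BalTensor.apply_eq_of_mk_eq ((balanced₃ ρ₁ τ₁ ρ₂ τ₂).mkQ ∘ₗ Δ.lTensor A)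
    (fun b x y => by simpa [h₁] using mk_tmul_eq ρ₁ τ₁ ρ₂ τ₂ b (Δ y) x) hy
  simp only [LinearMap.comp_apply, LinearEquiv.coe_coe, Submodule.mkQ_apply] at e₁ e₂
  rw [e₁, e₂, hΔ]

end Representatives

/-! ### From weak Hopf algebras over a commutative base to Hopf algebroids -/

/-- A weak Hopf algebra over a commutative base `B`: the coproduct takes values in `A ⊗_k A`, is
multiplicative but need not preserve the unit, and the counits and the antipode are given relative
to the commuting images of `B` under `s` and `t`. -/
structure WeakHopfData (k A B : Type*) [CommRing k] [Ring A] [Algebra k A]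
    [CommRing B] [Algebra k B] where
  s : B →ₐ[k] A
  t : B →ₐ[k] A
  s_mul_t : ∀ b c, s b * t c = t c * s b
  Δ : A →ₗ[k] A ⊗[k] A
  Δ_mul : ∀ a c, Δ (a * c) = Δ a * Δ c
  Δ_coassoc : ∀ a, TensorProduct.assoc k A A A (Δ.rTensor A (Δ a)) = Δ.lTensor A (Δ a)
  Δ_s_mul : ∀ b a, Δ (s b * a) = (s b ⊗ₜ 1) * Δ a
  Δ_mul_s : ∀ b a, Δ (a * s b) = Δ a * (s b ⊗ₜ 1)
  Δ_t_mul : ∀ b a, Δ (t b * a) = (1 ⊗ₜ t b) * Δ a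
  Δ_mul_t : ∀ b a, Δ (a * t b) = Δ a * (1 ⊗ₜ t b)
  balanced_left : ∀ b a, (t b ⊗ₜ 1) * Δ a = (1 ⊗ₜ s b) * Δ a
  balanced_right : ∀ b a, Δ a * (t b ⊗ₜ 1) = Δ a * (1 ⊗ₜ s b)
  -- The coproduct is unital only modulo the balancing relations, for the left and for the right
  -- quotient separately.
  Δ_one_left : Δ 1 - 1 ∈
    balanced (k := k) (fun b => LinearMap.mulLeft k (t b)) (fun b => LinearMap.mulLeft k (s b))
  Δ_one_right : Δ 1 - 1 ∈
    balanced (k := k) (fun b => LinearMap.mulRight k (t b)) (fun b => LinearMap.mulRight k (s b))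
  εL : A →ₗ[k] B
  εL_one : εL 1 = 1
  εL_s_mul : ∀ b a, εL (s b * a) = b * εL a
  εL_t_mul : ∀ b a, εL (t b * a) = b * εL a
  εL_mul_s : ∀ a c, εL (a * s (εL c)) = εL (a * c)
  εL_mul_t : ∀ a c, εL (a * t (εL c)) = εL (a * c)
  εR : A →ₗ[k] B
  εR_one : εR 1 = 1
  εR_mul_s : ∀ b a, εR (a * s b) = εR a * b
  εR_mul_t : ∀ b a, εR (a * t b) = εR a * b
  εR_s_mul : ∀ a c, εR (s (εR a) * c) = εR (a * c)
  εR_t_mul : ∀ a c, εR (t (εR a) * c) = εR (a * c)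
  εL_left : ∀ a, LinearMap.mul' k A
    (TensorProduct.map (s.toLinearMap ∘ₗ εL) LinearMap.id (Δ a)) = a
  εL_right : ∀ a, LinearMap.mul' k A
    (TensorProduct.map (t.toLinearMap ∘ₗ εL) LinearMap.id (TensorProduct.comm k A A (Δ a))) = a
  εR_right : ∀ a, LinearMap.mul' k A
    (TensorProduct.map LinearMap.id (t.toLinearMap ∘ₗ εR) (Δ a)) = a
  εR_left : ∀ a, LinearMap.mul' k A
    (TensorProduct.map LinearMap.id (s.toLinearMap ∘ₗ εR) (TensorProduct.comm k A A (Δ a))) = a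
  S : A →ₗ[k] A
  S_t_mul : ∀ b a, S (t b * a) = S a * s b
  S_mul_s : ∀ b a, S (a * s b) = t b * S a
  S_left : ∀ a, LinearMap.mul' k A (TensorProduct.map S LinearMap.id (Δ a)) = t (εR a)
  S_right : ∀ a, LinearMap.mul' k A (TensorProduct.map LinearMap.id S (Δ a)) = s (εL a)

namespace WeakHopfData

variable {k A B : Type*} [CommRing k] [Ring A] [Algebra k A] [CommRing B] [Algebra k B]
  (W : WeakHopfData k A B)

/-- `t` as a map on the opposite algebra. -/
def tOp : Bᵐᵒᵖ →ₐ[k] A := W.t.fromOpposite fun x y => (Commute.all x y).map W.t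

/-- `s` as a map on the opposite algebra. -/
def sOp : Bᵐᵒᵖ →ₐ[k] A := W.s.fromOpposite fun x y => (Commute.all x y).map W.s

@[simp] lemma tOp_op (b : B) : W.tOp (MulOpposite.op b) = W.t b := rfl

@[simp] lemma sOp_op (b : B) : W.sOp (MulOpposite.op b) = W.s b := rfl

lemma lTensor_mulLeft (c : A) (x : A ⊗[k] A) :
    (LinearMap.mulLeft k c).lTensor A x = (1 ⊗ₜ c) * x := by
  induction x with
  | zero => simp
  | add x y hx hy => simp only [map_add, hx, hy, mul_add]
  | tmul x y => simp

lemma rTensor_mulLeft (c : A) (x : A ⊗[k] A) :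
    (LinearMap.mulLeft k c).rTensor A x = (c ⊗ₜ 1) * x := by
  induction x with
  | zero => simp
  | add x y hx hy => simp only [map_add, hx, hy, mul_add]
  | tmul x y => simp

lemma lTensor_mulRight (c : A) (x : A ⊗[k] A) :
    (LinearMap.mulRight k c).lTensor A x = x * (1 ⊗ₜ c) := by
  induction x with
  | zero => simp
  | add x y hx hy => simp only [map_add, hx, hy, add_mul]
  | tmul x y => simp

lemma rTensor_mulRight (c : A) (x : A ⊗[k] A) :
    (LinearMap.mulRight k c).rTensor A x = x * (c ⊗ₜ 1) := by
  induction x with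
  | zero => simp
  | add x y hx hy => simp only [map_add, hx, hy, add_mul]
  | tmul x y => simp

/-- Left multiplications on `A ⊗_B A` for the left bialgebroid structure. -/
abbrev ρL (b : B) : A →ₗ[k] A := LinearMap.mulLeft k (W.tOp (MulOpposite.op b))

/-- See `ρL`. -/
abbrev τL (b : B) : A →ₗ[k] A := LinearMap.mulLeft k (W.s b)

/-- Right multiplications on `A ⊗_B A` for the right bialgebroid structure. -/
abbrev ρR (b : B) : A →ₗ[k] A := LinearMap.mulRight k (W.t b)

/-- See `ρR`. -/
abbrev τR (b : B) : A →ₗ[k] A := LinearMap.mulRight k (W.sOp (MulOpposite.op b))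

/-- The left balancing relations are given by left multiplications, so they are stable under right
multiplication by all of A ⊗ A. -/
lemma mk_mul_left (x y : A ⊗[k] A) (z : A ⊗[k] A)
    (h : (Submodule.Quotient.mk x : BalTensor W.ρL W.τL) = Submodule.Quotient.mk y) :
    (Submodule.Quotient.mk (x * z) : BalTensor W.ρL W.τL) = Submodule.Quotient.mk (y * z) := by
  refine BalTensor.apply_eq_of_mk_eq ((balanced W.ρL W.τL).mkQ ∘ₗ LinearMap.mulRight k z) ?_ h
  intro b x y
  simp only [LinearMap.comp_apply, LinearMap.mulRight_apply, Submodule.mkQ_apply]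
  induction z with
  | zero => simp
  | add x y hx hy => simp only [mul_add, Submodule.Quotient.mk_add, hx, hy]
  | tmul u v =>
    simpa [mul_assoc] using BalTensor.mk_eq_mk W.ρL W.τL b (x * u) (y * v)

lemma mk_mul_right (x y : A ⊗[k] A) (z : A ⊗[k] A)
    (h : (Submodule.Quotient.mk x : BalTensor W.ρR W.τR) = Submodule.Quotient.mk y) :
    (Submodule.Quotient.mk (z * x) : BalTensor W.ρR W.τR) = Submodule.Quotient.mk (z * y) := by
  refine BalTensor.apply_eq_of_mk_eq ((balanced W.ρR W.τR).mkQ ∘ₗ LinearMap.mulLeft k z) ?_ h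
  intro b x y
  simp only [LinearMap.comp_apply, LinearMap.mulLeft_apply, Submodule.mkQ_apply]
  induction z with
  | zero => simp
  | add x y hx hy => simp only [add_mul, Submodule.Quotient.mk_add, hx, hy]
  | tmul u v =>
    simpa [mul_assoc] using BalTensor.mk_eq_mk W.ρR W.τR b (u * x) (v * y)

/-- The left bialgebroid of a weak Hopf algebra. -/
def leftBialgebroid : LeftBialgebroid k A B where
  source := W.s
  target := W.tOp
  source_target_comm l l' := W.s_mul_t l l'.unop
  comul := (balanced W.ρL W.τL).mkQ ∘ₗ W.Δ
  counit := W.εL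
  comul_bimodule l l' a x hx := by
    have h := BalTensor.apply_eq_of_mk_eq ((balanced W.ρL W.τL).mkQ ∘ₗ
      LinearMap.mulLeft k (W.s l ⊗ₜ W.t l')) (fun b x y => ?_) hx
    · have e : W.Δ (W.s l * W.t l' * a) = (W.s l ⊗ₜ W.t l') * W.Δ a := by
        rw [mul_assoc, W.Δ_s_mul, W.Δ_t_mul, ← mul_assoc, Algebra.TensorProduct.tmul_mul_tmul,
          mul_one, one_mul]
      exact (congrArg Submodule.Quotient.mk e).trans h.symm
    · have h₁ : W.s l * (W.t b * x) = W.t b * (W.s l * x) := by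
        rw [← mul_assoc, W.s_mul_t, mul_assoc]
      have h₂ : W.t l' * (W.s b * y) = W.s b * (W.t l' * y) := by
        rw [← mul_assoc, ← W.s_mul_t, mul_assoc]
      simpa [h₁, h₂] using BalTensor.mk_eq_mk W.ρL W.τL b (W.s l * x) (W.t l' * y)
  counit_bimodule l l' a := by
    rw [mul_assoc, tOp_op, W.εL_s_mul, W.εL_t_mul, mul_assoc, mul_comm l']
  coassoc a x y hx hy := glue_coassoc _ _ _ _ W.Δ W.Δ_coassoc
    (fun b a => by rw [lTensor_mulLeft]; exact W.Δ_t_mul b a)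
    (fun b a => by rw [rTensor_mulLeft]; exact W.Δ_s_mul b a) a x y hx hy
  counit_comul a x hx := by
    refine (BalTensor.apply_eq_of_mk_eq (LinearMap.mul' k A ∘ₗ TensorProduct.map
      (W.s.toLinearMap ∘ₗ W.εL) LinearMap.id) (fun b x y => ?_) hx).trans (W.εL_left a)
    simp [W.εL_t_mul, mul_comm b, mul_assoc]
  comul_counit a x hx := by
    refine (BalTensor.apply_eq_of_mk_eq (LinearMap.mul' k A ∘ₗ TensorProduct.map
      (W.t.toLinearMap ∘ₗ W.εL) LinearMap.id ∘ₗ (TensorProduct.comm k A A).toLinearMap)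
      (fun b x y => ?_) hx).trans (W.εL_right a)
    simp [W.εL_s_mul, mul_comm b, mul_assoc]
  takeuchi l a x hx := by
    refine (W.mk_mul_left _ _ _ hx).trans (Eq.trans ?_ (W.mk_mul_left _ _ _ hx).symm)
    exact congrArg _ (W.balanced_right l a)
  comul_one := (Submodule.Quotient.eq _).2 W.Δ_one_left
  comul_mul a b x y hx hy := by
    -- Left multiplication does not respect the left balancing in general. Multiplication by `Δ a`
    -- does, because `Δ a` absorbs t(b) ⊗ 1 and 1 ⊗ s(b) on its right in the same way.
    have h := BalTensor.apply_eq_of_mk_eq ((balanced W.ρL W.τL).mkQ ∘ₗ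
      LinearMap.mulLeft k (W.Δ a)) (fun b x y => ?_) hy
    · rw [W.mk_mul_left _ _ y hx]
      simp only [LinearMap.comp_apply, Submodule.mkQ_apply, LinearMap.mulLeft_apply] at h ⊢
      rw [W.Δ_mul, h]
    · simp only [LinearMap.comp_apply, Submodule.mkQ_apply, LinearMap.mulLeft_apply]
      have h₁ : (W.tOp (MulOpposite.op b) * x) ⊗ₜ[k] y = (W.t b ⊗ₜ 1) * (x ⊗ₜ y) := by simp
      have h₂ : x ⊗ₜ[k] (W.s b * y) = (1 ⊗ₜ W.s b) * (x ⊗ₜ y) := by simp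
      rw [h₁, h₂, ← mul_assoc, ← mul_assoc, W.balanced_right]
  counit_one := W.εL_one
  counit_mul_source := W.εL_mul_s
  counit_mul_target := W.εL_mul_t

/-- The right bialgebroid of a weak Hopf algebra. -/
def rightBialgebroid : RightBialgebroid k A B where
  source := W.t
  target := W.sOp
  source_target_comm l l' := (W.s_mul_t l'.unop l).symm
  comul := (balanced W.ρR W.τR).mkQ ∘ₗ W.Δ
  counit := W.εR
  comul_bimodule l l' a x hx := by
    have h := BalTensor.apply_eq_of_mk_eq ((balanced W.ρR W.τR).mkQ ∘ₗ
      LinearMap.mulRight k (W.s l ⊗ₜ W.t l')) (fun b x y => ?_) hx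
    · have e : W.Δ (a * W.t l' * W.s l) = W.Δ a * (W.s l ⊗ₜ W.t l') := by
        rw [W.Δ_mul_s, W.Δ_mul_t, mul_assoc, Algebra.TensorProduct.tmul_mul_tmul, mul_one, one_mul]
      exact (congrArg Submodule.Quotient.mk e).trans h.symm
    · have h₁ : x * W.t b * W.s l = x * W.s l * W.t b := by
        rw [mul_assoc, ← W.s_mul_t, mul_assoc]
      have h₂ : y * W.s b * W.t l' = y * W.t l' * W.s b := by
        rw [mul_assoc, W.s_mul_t, mul_assoc]
      simpa [h₁, h₂] using BalTensor.mk_eq_mk W.ρR W.τR b (x * W.s l) (y * W.t l')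
  counit_bimodule l l' a := by
    rw [sOp_op, W.εR_mul_s, W.εR_mul_t, mul_comm, ← mul_assoc]
  coassoc a x y hx hy := glue_coassoc _ _ _ _ W.Δ W.Δ_coassoc
    (fun b a => by rw [lTensor_mulRight]; exact W.Δ_mul_t b a)
    (fun b a => by rw [rTensor_mulRight]; exact W.Δ_mul_s b a) a x y hx hy
  comul_counit a x hx := by
    refine (BalTensor.apply_eq_of_mk_eq (LinearMap.mul' k A ∘ₗ TensorProduct.map
      LinearMap.id (W.t.toLinearMap ∘ₗ W.εR)) (fun b x y => ?_) hx).trans (W.εR_right a)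
    simp [W.εR_mul_s, mul_comm _ b, mul_assoc]
  counit_comul a x hx := by
    refine (BalTensor.apply_eq_of_mk_eq (LinearMap.mul' k A ∘ₗ TensorProduct.map
      LinearMap.id (W.s.toLinearMap ∘ₗ W.εR) ∘ₗ (TensorProduct.comm k A A).toLinearMap)
      (fun b x y => ?_) hx).trans (W.εR_left a)
    simp [W.εR_mul_t, mul_comm _ b, mul_assoc]
  takeuchi l a x hx := by
    refine (W.mk_mul_right _ _ _ hx).trans (Eq.trans ?_ (W.mk_mul_right _ _ _ hx).symm)
    exact congrArg _ (W.balanced_left l a)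
  comul_one := (Submodule.Quotient.eq _).2 W.Δ_one_right
  comul_mul a b x y hx hy := by
    have h := BalTensor.apply_eq_of_mk_eq ((balanced W.ρR W.τR).mkQ ∘ₗ
      LinearMap.mulRight k (W.Δ b)) (fun b x y => ?_) hx
    · rw [W.mk_mul_right _ _ x hy]
      simp only [LinearMap.comp_apply, Submodule.mkQ_apply, LinearMap.mulRight_apply] at h ⊢
      rw [W.Δ_mul, h]
    · simp only [LinearMap.comp_apply, Submodule.mkQ_apply, LinearMap.mulRight_apply]
      have h₁ : (x * W.t b) ⊗ₜ[k] y = (x ⊗ₜ y) * (W.t b ⊗ₜ 1) := by simp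
      have h₂ : x ⊗ₜ[k] (y * W.sOp (MulOpposite.op b)) = (x ⊗ₜ y) * (1 ⊗ₜ W.s b) := by simp
      rw [h₁, h₂, mul_assoc, mul_assoc, W.balanced_left]
  counit_one := W.εR_one
  counit_source_mul := W.εR_t_mul
  counit_target_mul := W.εR_s_mul

lemma εL_s (b : B) : W.εL (W.s b) = b := by
  simpa [W.εL_one] using W.εL_s_mul b 1

lemma εL_t (b : B) : W.εL (W.t b) = b := by
  simpa [W.εL_one] using W.εL_t_mul b 1

lemma εR_s (b : B) : W.εR (W.s b) = b := by
  simpa [W.εR_one] using W.εR_mul_s b 1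

lemma εR_t (b : B) : W.εR (W.t b) = b := by
  simpa [W.εR_one] using W.εR_mul_t b 1

/-- The Hopf algebroid of a weak Hopf algebra. -/
def hopfAlgebroid : HopfAlgebroid k A B B where
  left := W.leftBialgebroid
  right := W.rightBialgebroid
  antipode := W.S
  sL_pL_tR n := congrArg W.s (W.εL_s n.unop)
  tL_pL_sR n := congrArg W.t (W.εL_t n)
  sR_pR_tL l := congrArg W.t (W.εR_t l.unop)
  tR_pR_sL l := congrArg W.s (W.εR_s l)
  mixed_coassoc_LR a x y hx hy := glue_coassoc _ _ _ _ W.Δ W.Δ_coassoc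
    (fun b a => by rw [lTensor_mulRight]; exact W.Δ_mul_t b a)
    (fun b a => by rw [rTensor_mulLeft]; exact W.Δ_s_mul b a) a x y hx hy
  mixed_coassoc_RL a x y hx hy := glue_coassoc _ _ _ _ W.Δ W.Δ_coassoc
    (fun b a => by rw [lTensor_mulLeft]; exact W.Δ_t_mul b a)
    (fun b a => by rw [rTensor_mulRight]; exact W.Δ_mul_s b a) a x y hx hy
  antipode_bimodule l n a := by
    change W.S (W.t l * a * W.s n) = W.t n * W.S a * W.s l
    rw [W.S_mul_s, W.S_t_mul, mul_assoc]
  antipode_left a x hx := by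
    refine (BalTensor.apply_eq_of_mk_eq (LinearMap.mul' k A ∘ₗ TensorProduct.map
      W.S LinearMap.id) (fun b x y => ?_) hx).trans (W.S_left a)
    change W.S (W.t b * x) * y = W.S x * (W.s b * y)
    rw [W.S_t_mul, mul_assoc]
  antipode_right a x hx := by
    refine (BalTensor.apply_eq_of_mk_eq (LinearMap.mul' k A ∘ₗ TensorProduct.map
      LinearMap.id W.S) (fun b x y => ?_) hx).trans (W.S_right a)
    change x * W.t b * W.S y = x * W.S (y * W.s b)
    rw [W.S_mul_s, mul_assoc]

end WeakHopfData

/-! ### The universal property of A_σ -/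

section Generators

variable (K : Type*) [Field K] {Q : Type*} [Mul Q] [Fintype Q] (σ : Q → Q × Q → Q × Q)

/-- The inclusion of `M_Q ⊗ M_Q` into `A_σ`. -/
def coeffHom : (Q → K) ⊗[K] (Q → K) →ₐ[K] FRTAlgebra K σ :=
  AlgHom.ofLinearMap
    { toFun := aC K σ
      map_add' := fun ξ ξ' => by
        rw [aC, aC, aC, ← map_add]
        exact (RingQuot.mkAlgHom_rel K (FRTRel.add ξ ξ')).symm
      map_smul' := fun c ξ => by
        rw [RingHom.id_apply, aC, aC, ← map_smul]
        exact (RingQuot.mkAlgHom_rel K (FRTRel.smul c ξ)).symm }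
    ((RingQuot.mkAlgHom_rel K FRTRel.one).symm.trans (map_one _))
    (fun ξ ξ' => by
      change aC K σ _ = aC K σ _ * aC K σ _
      rw [aC, aC, aC, ← map_mul]
      exact (RingQuot.mkAlgHom_rel K (FRTRel.mul ξ ξ')).symm)

lemma coeffHom_apply (ξ : (Q → K) ⊗[K] (Q → K)) : coeffHom K σ ξ = aC K σ ξ := rfl

variable {B : Type*} [Ring B] [Algebra K B]

/-- Images of the generators of `A_σ` in another algebra that satisfy the defining relations. -/
structure FRTImage (B : Type*) [Ring B] [Algebra K B] where
  u : (Q → K) →ₐ[K] B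
  v : (Q → K) →ₐ[K] B
  comm : ∀ f g, Commute (u f) (v g)
  ℓ : Q → Q → B
  ℓ' : Q → Q → B
  sum_ℓ_ℓ' : ∀ a b, ∑ c, ℓ a c * ℓ' c b = delta K a b • (1 : B)
  sum_ℓ'_ℓ : ∀ a b, ∑ c, ℓ' a c * ℓ c b = delta K a b • (1 : B)
  u_ℓ : ∀ f a b, u (shift a f) * ℓ a b = ℓ a b * u f
  v_ℓ : ∀ f a b, v (shift b f) * ℓ a b = ℓ a b * v f
  u_ℓ' : ∀ f a b, u f * ℓ' a b = ℓ' a b * u (shift b f)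
  v_ℓ' : ∀ f a b, v f * ℓ' a b = ℓ' a b * v (shift a f)
  rll : ∀ a b c d, ∑ x, ∑ y, u (sigmaCoeff K σ x y a c) * ℓ y d * ℓ x b =
    ∑ x, ∑ y, v (sigmaCoeff K σ b d x y) * ℓ c y * ℓ a x

namespace FRTImage

variable {K σ} (D : FRTImage K σ B)

/-- The map on the free algebra. -/
def freeLift : FRTFree K Q →ₐ[K] B := FreeAlgebra.lift K fun g => match g with
  | .coeff ξ => Algebra.TensorProduct.lift D.u D.v D.comm ξ
  | .L a b => D.ℓ a b
  | .Linv a b => D.ℓ' a b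

@[simp] lemma freeLift_fC (ξ : (Q → K) ⊗[K] (Q → K)) :
    D.freeLift (fC K ξ) = Algebra.TensorProduct.lift D.u D.v D.comm ξ := by
  simp [freeLift, fC]

@[simp] lemma freeLift_fL (a b : Q) : D.freeLift (fL K a b) = D.ℓ a b := by simp [freeLift, fL]

@[simp] lemma freeLift_fLinv (a b : Q) : D.freeLift (fLinv K a b) = D.ℓ' a b := by
  simp [freeLift, fLinv]

/-- The induced algebra map on `A_σ`. -/
def liftAux : FRTAlgebra K σ →ₐ[K] B := RingQuot.liftAlgHom K ⟨D.freeLift, by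
  intro x y h
  induction h with
  | add ξ ξ' => simp
  | smul c ξ => simp
  | mul ξ ξ' => simp
  | one => simp [← Algebra.TensorProduct.one_def]
  | L_Linv a b => simpa using D.sum_ℓ_ℓ' a b
  | Linv_L a b => simpa using D.sum_ℓ'_ℓ a b
  | left_L f a b => simpa using D.u_ℓ f a b
  | right_L f a b => simpa using D.v_ℓ f a b
  | left_Linv f a b => simpa using D.u_ℓ' f a b
  | right_Linv f a b => simpa using D.v_ℓ' f a b
  | rll a b c d => simpa using D.rll a b c d⟩

end FRTImage

/-- The generators of `A_σ` satisfy the defining relations. -/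
def frtImage : FRTImage K σ (FRTAlgebra K σ) where
  u := (coeffHom K σ).comp Algebra.TensorProduct.includeLeft
  v := (coeffHom K σ).comp Algebra.TensorProduct.includeRight
  comm f g := by
    change coeffHom K σ (f ⊗ₜ 1) * coeffHom K σ (1 ⊗ₜ g) =
      coeffHom K σ (1 ⊗ₜ g) * coeffHom K σ (f ⊗ₜ 1)
    rw [← map_mul, ← map_mul, mul_comm]
  ℓ := aL K σ
  ℓ' := aLinv K σ
  sum_ℓ_ℓ' a b := by
    simpa [aL, aLinv] using RingQuot.mkAlgHom_rel K (FRTRel.L_Linv (K := K) (σ := σ) a b)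
  sum_ℓ'_ℓ a b := by
    simpa [aL, aLinv] using RingQuot.mkAlgHom_rel K (FRTRel.Linv_L (K := K) (σ := σ) a b)
  u_ℓ f a b := by
    simpa [coeffHom_apply, aC, aL] using
      RingQuot.mkAlgHom_rel K (FRTRel.left_L (K := K) (σ := σ) f a b)
  v_ℓ f a b := by
    simpa [coeffHom_apply, aC, aL] using
      RingQuot.mkAlgHom_rel K (FRTRel.right_L (K := K) (σ := σ) f a b)
  u_ℓ' f a b := by
    simpa [coeffHom_apply, aC, aLinv] using
      RingQuot.mkAlgHom_rel K (FRTRel.left_Linv (K := K) (σ := σ) f a b)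
  v_ℓ' f a b := by
    simpa [coeffHom_apply, aC, aLinv] using
      RingQuot.mkAlgHom_rel K (FRTRel.right_Linv (K := K) (σ := σ) f a b)
  rll a b c d := by
    simpa [coeffHom_apply, aC, aL] using
      RingQuot.mkAlgHom_rel K (FRTRel.rll (K := K) (σ := σ) a b c d)

/-- The algebra `A_σ` behind a type synonym, which keeps unification fast. -/
def FRTAlg : Type _ := FRTAlgebra K σ

instance : Ring (FRTAlg K σ) := inferInstanceAs (Ring (FRTAlgebra K σ))

instance : Algebra K (FRTAlg K σ) := inferInstanceAs (Algebra K (FRTAlgebra K σ))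

/-- The map `f ↦ f ⊗ 1`. -/
def src : (Q → K) →ₐ[K] FRTAlg K σ := (frtImage K σ).u

/-- The map `f ↦ 1 ⊗ f`. -/
def tgt : (Q → K) →ₐ[K] FRTAlg K σ := (frtImage K σ).v

/-- The generator `L_{ab}`. -/
def genL (a b : Q) : FRTAlg K σ := aL K σ a b

/-- The generator `(L⁻¹)_{ab}`. -/
def genLinv (a b : Q) : FRTAlg K σ := aLinv K σ a b

lemma src_tgt_comm (f g : Q → K) : src K σ f * tgt K σ g = tgt K σ g * src K σ f :=
  (frtImage K σ).comm f g

lemma sum_genL_genLinv (a b : Q) :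
    ∑ c, genL K σ a c * genLinv K σ c b = delta K a b • (1 : FRTAlg K σ) :=
  (frtImage K σ).sum_ℓ_ℓ' a b

lemma sum_genLinv_genL (a b : Q) :
    ∑ c, genLinv K σ a c * genL K σ c b = delta K a b • (1 : FRTAlg K σ) :=
  (frtImage K σ).sum_ℓ'_ℓ a b

lemma src_mul_genL (f : Q → K) (a b : Q) :
    src K σ (shift a f) * genL K σ a b = genL K σ a b * src K σ f :=
  (frtImage K σ).u_ℓ f a b

lemma tgt_mul_genL (f : Q → K) (a b : Q) :
    tgt K σ (shift b f) * genL K σ a b = genL K σ a b * tgt K σ f :=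
  (frtImage K σ).v_ℓ f a b

lemma src_mul_genLinv (f : Q → K) (a b : Q) :
    src K σ f * genLinv K σ a b = genLinv K σ a b * src K σ (shift b f) :=
  (frtImage K σ).u_ℓ' f a b

lemma tgt_mul_genLinv (f : Q → K) (a b : Q) :
    tgt K σ f * genLinv K σ a b = genLinv K σ a b * tgt K σ (shift a f) :=
  (frtImage K σ).v_ℓ' f a b

lemma rll (a b c d : Q) :
    ∑ x, ∑ y, src K σ (sigmaCoeff K σ x y a c) * genL K σ y d * genL K σ x b =
      ∑ x, ∑ y, tgt K σ (sigmaCoeff K σ b d x y) * genL K σ c y * genL K σ a x :=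
  (frtImage K σ).rll a b c d

variable {K σ} in
/-- Induction on the generators of `A_σ`. -/
lemma frt_induction {P : FRTAlg K σ → Prop} (hs : ∀ f, P (src K σ f))
    (ht : ∀ f, P (tgt K σ f)) (hL : ∀ a b, P (genL K σ a b)) (hL' : ∀ a b, P (genLinv K σ a b))
    (hadd : ∀ a b, P a → P b → P (a + b)) (hmul : ∀ a b, P a → P b → P (a * b))
    (a : FRTAlg K σ) : P a := by
  obtain ⟨w, rfl⟩ := RingQuot.mkAlgHom_surjective K (FRTRel K σ) a
  induction w using FreeAlgebra.induction with
  | grade0 c =>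
    have h := hs (algebraMap K (Q → K) c)
    rw [AlgHom.commutes] at h
    rw [AlgHom.commutes]
    exact h
  | grade1 x =>
    cases x with
    | L a b => exact hL a b
    | Linv a b => exact hL' a b
    | coeff ξ =>
      change P (coeffHom K σ ξ)
      induction ξ with
      | zero =>
        have h := hs 0
        rw [map_zero] at h ⊢
        exact h
      | add x y hx hy => rw [map_add]; exact hadd _ _ hx hy
      | tmul f g =>
        have e : f ⊗ₜ[K] g = (f ⊗ₜ 1) * (1 ⊗ₜ g) := by simp
        rw [e, map_mul]
        exact hmul _ _ (hs f) (ht g)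
  | mul a b ha hb => rw [map_mul]; exact hmul _ _ ha hb
  | add a b ha hb => rw [map_add]; exact hadd _ _ ha hb

namespace FRTImage

variable {K σ} (D : FRTImage K σ B)

/-- The induced algebra map on `A_σ`. -/
def lift : FRTAlg K σ →ₐ[K] B := D.liftAux

@[simp] lemma lift_src (f : Q → K) : D.lift (src K σ f) = D.u f :=
  (RingQuot.liftAlgHom_mkAlgHom_apply ..).trans (by simp)

@[simp] lemma lift_tgt (f : Q → K) : D.lift (tgt K σ f) = D.v f :=
  (RingQuot.liftAlgHom_mkAlgHom_apply ..).trans (by simp)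

@[simp] lemma lift_genL (a b : Q) : D.lift (genL K σ a b) = D.ℓ a b :=
  (RingQuot.liftAlgHom_mkAlgHom_apply ..).trans (by simp)

@[simp] lemma lift_genLinv (a b : Q) : D.lift (genLinv K σ a b) = D.ℓ' a b :=
  (RingQuot.liftAlgHom_mkAlgHom_apply ..).trans (by simp)

end FRTImage

end Generators

/-! ### Corners of rings as algebras with unit e -/

section Corner

variable {k B C : Type*} [CommRing k] [Ring B] [Algebra k B] [Ring C] [Algebra k C] {e : B}
  (he : IsIdempotentElem e)

/-- The corner `e B e` of a ring. -/
abbrev CornerRing {B : Type*} [Ring B] {e : B} (he : IsIdempotentElem e) : Type _ := he.Corner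

/-- The element `e x` of the corner `e B e` for `x` commuting with `e`. -/
def cornerMk (x : B) (hx : Commute e x) : CornerRing he :=
  ⟨e * x, x, show e * x * e = e * x by rw [hx.eq, mul_assoc, he.eq]⟩

lemma corner_mul_left (x : CornerRing he) : e * x.1 = x.1 := congrArg Subtype.val (one_mul x)

lemma corner_mul_right (x : CornerRing he) : x.1 * e = x.1 := congrArg Subtype.val (mul_one x)

/-- The unit of the corner is `e`, so a scalar `c` must be embedded as `e` times its image in `B`.
-/
instance cornerAlgebra : Algebra k (CornerRing he) :=
  RingHom.toAlgebra'
    { toFun := fun c => cornerMk he (algebraMap k B c) (Algebra.commute_algebraMap_right c e)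
      map_one' := Subtype.ext (by
        change e * algebraMap k B 1 = e
        rw [map_one, mul_one])
      map_mul' := fun c d => Subtype.ext (by
        change e * algebraMap k B (c * d) = e * algebraMap k B c * (e * algebraMap k B d)
        rw [map_mul, ← mul_assoc, mul_assoc _ _ (e * _), ← mul_assoc _ e, Algebra.commutes c e,
          ← mul_assoc, ← mul_assoc, he.eq])
      map_zero' := Subtype.ext (by
        change e * algebraMap k B 0 = 0
        rw [map_zero, mul_zero])
      map_add' := fun c d => Subtype.ext (by
        change e * algebraMap k B (c + d) = e * algebraMap k B c + e * algebraMap k B d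
        rw [map_add, mul_add]) }
    fun c x => Subtype.ext (by
      change e * algebraMap k B c * x.1 = x.1 * (e * algebraMap k B c)
      rw [mul_assoc, Algebra.commutes, ← mul_assoc, ← mul_assoc, corner_mul_left, corner_mul_right])

variable (k) in
/-- The inclusion of the corner. -/
def cornerVal : CornerRing he →ₗ[k] B where
  toFun := Subtype.val
  map_add' _ _ := rfl
  map_smul' c x := by
    change e * algebraMap k B c * x.1 = c • x.1
    rw [← Algebra.commutes, mul_assoc, corner_mul_left, Algebra.smul_def]

lemma cornerVal_injective : Function.Injective (cornerVal k he) := Subtype.val_injective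

@[simp] lemma cornerVal_mul (x y : CornerRing he) :
    cornerVal k he (x * y) = cornerVal k he x * cornerVal k he y := rfl

@[simp] lemma cornerVal_one : cornerVal k he 1 = e := rfl

@[simp] lemma cornerVal_cornerMk (x : B) (hx : Commute e x) :
    cornerVal k he (cornerMk he x hx) = e * x := rfl

lemma cornerMk_mul_cornerMk (x y : B) (hx : Commute e x) (hy : Commute e y) :
    cornerMk he x hx * cornerMk he y hy = cornerMk he (x * y) (hx.mul_right hy) :=
  Subtype.ext (by
    change e * x * (e * y) = e * (x * y)
    rw [hx.eq, mul_assoc, ← mul_assoc e, he.eq, ← mul_assoc, ← hx.eq, mul_assoc])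

/-- An algebra map whose values commute with `e` gives an algebra map to the corner. -/
def cornerHom (f : C →ₐ[k] B) (hf : ∀ c, Commute e (f c)) : C →ₐ[k] CornerRing he :=
  AlgHom.ofLinearMap
    { toFun := fun c => cornerMk he (f c) (hf c)
      map_add' := fun c d => cornerVal_injective (k := k) he (by simp [mul_add])
      map_smul' := fun c d => cornerVal_injective (k := k) he (by simp) }
    (cornerVal_injective (k := k) he (by simp))
    (fun c d => by
      simp only [LinearMap.coe_mk, AddHom.coe_mk, map_mul, cornerMk_mul_cornerMk])

lemma cornerHom_apply (f : C →ₐ[k] B) (hf : ∀ c, Commute e (f c)) (c : C) :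
    cornerHom he f hf c = cornerMk he (f c) (hf c) := rfl

end Corner

/-! ### Delta functions and division in a quasigroup -/

section Points

variable (K : Type*) [Field K] {Q : Type*}

lemma mul_delta (f : Q → K) (l : Q) : f * delta K l = f l • delta K l := by
  ext m
  by_cases h : l = m <;> simp [delta, h]

lemma delta_mul (f : Q → K) (l : Q) : delta K l * f = f l • delta K l := by
  rw [mul_comm, mul_delta]

lemma delta_mul_self (l : Q) : delta K l * delta K l = delta K l := by
  rw [mul_delta]; simp [delta]

lemma sum_delta_smul [Fintype Q] {V : Type*} [AddCommMonoid V] [Module K V]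
    (a : Q) (v : Q → V) :
    ∑ c, delta K a c • v c = v a := by
  classical
  rw [Finset.sum_eq_single a (fun c _ h => by simp [delta, h.symm]) (by simp)]
  simp [delta]

lemma delta_comm (a b : Q) : delta K a b = delta K b a := by
  by_cases h : a = b
  · rw [h]
  · simp [delta, h, Ne.symm h]

lemma sum_delta [Fintype Q] : ∑ l, delta K l = (1 : Q → K) := by
  ext m
  have h := sum_delta_smul K m (fun _ => (1 : K))
  simp_rw [smul_eq_mul, mul_one, delta_comm K m] at h
  simpa using h

variable [Mul Q] [IsQuasigroup Q]

lemma mul_left_bijective' (u : Q) : Function.Bijective fun v => u * v :=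
  (Function.bijective_iff_existsUnique _).2 (IsQuasigroup.existsUnique_mul_left u)

lemma mul_right_bijective' (v : Q) : Function.Bijective fun u => u * v :=
  (Function.bijective_iff_existsUnique _).2 (IsQuasigroup.existsUnique_mul_right v)

lemma mul_ldiv (u w : Q) : u * ldiv u w = w :=
  (IsQuasigroup.existsUnique_mul_left u w).choose_spec.1

lemma ldiv_mul (u v : Q) : ldiv u (u * v) = v :=
  (mul_left_bijective' u).1 (mul_ldiv u _)

lemma eq_ldiv_iff (u v w : Q) : v = ldiv u w ↔ u * v = w :=
  ⟨fun h => h ▸ mul_ldiv u w, fun h => h ▸ (ldiv_mul u v).symm⟩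

lemma shift_delta (l a : Q) : shift a (delta K (l * a)) = delta K l := by
  ext m
  by_cases h : l = m
  · simp [shift, delta, h]
  · have h' : l * a ≠ m * a := fun e => h ((mul_right_bijective' a).1 e)
    simp [shift, delta, h, h']

end Points

/-! ### The coproduct with values in the corner of the separability idempotent -/

section Coproduct

variable (K : Type*) [Field K] {Q : Type*} [Mul Q] [IsQuasigroup Q] [Fintype Q]
  (σ : Q → Q × Q → Q × Q)

/-- The idempotent `∑ t(e_l) ⊗ s(e_l)`. -/
def sepIdem : FRTAlg K σ ⊗[K] FRTAlg K σ :=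
  ∑ l, tgt K σ (delta K l) ⊗ₜ src K σ (delta K l)

/-- Since e_l f = f(l) e_l, both sides put the scalar f(l) on the l-th summand, and a scalar may
move across the tensor sign. The idempotent thus realizes the balancing relation as an equality in A
⊗ A. -/
lemma sepIdem_mul_tgt (f : Q → K) :
    sepIdem K σ * (tgt K σ f ⊗ₜ 1) = sepIdem K σ * (1 ⊗ₜ src K σ f) := by
  simp only [sepIdem, Finset.sum_mul, Algebra.TensorProduct.tmul_mul_tmul, mul_one, ← map_mul,
    delta_mul, map_smul, TensorProduct.smul_tmul]

lemma tgt_mul_sepIdem (f : Q → K) :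
    (tgt K σ f ⊗ₜ 1) * sepIdem K σ = (1 ⊗ₜ src K σ f) * sepIdem K σ := by
  simp only [sepIdem, Finset.mul_sum, Algebra.TensorProduct.tmul_mul_tmul, one_mul, ← map_mul,
    mul_delta, map_smul, TensorProduct.smul_tmul]

lemma sepIdem_idem : IsIdempotentElem (sepIdem K σ) := by
  have h : ∀ l, sepIdem K σ * (tgt K σ (delta K l) ⊗ₜ src K σ (delta K l)) =
      sepIdem K σ * (1 ⊗ₜ src K σ (delta K l)) := fun l => by
    have := congrArg (· * ((1 : FRTAlg K σ) ⊗ₜ[K] src K σ (delta K l)))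
      (sepIdem_mul_tgt K σ (delta K l))
    simpa [mul_assoc, ← map_mul, delta_mul_self] using this
  unfold IsIdempotentElem
  conv_lhs => rhs; rw [sepIdem]
  rw [Finset.mul_sum]
  simp_rw [h]
  rw [← Finset.mul_sum, ← TensorProduct.tmul_sum, ← map_sum, sum_delta, map_one]
  exact mul_one _

lemma sepIdem_comm_src (f : Q → K) : Commute (sepIdem K σ) (src K σ f ⊗ₜ 1) := by
  simp only [Commute, SemiconjBy, sepIdem, Finset.sum_mul, Finset.mul_sum,
    Algebra.TensorProduct.tmul_mul_tmul, mul_one, one_mul, src_tgt_comm]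

lemma sepIdem_comm_tgt (f : Q → K) : Commute (sepIdem K σ) (1 ⊗ₜ tgt K σ f) := by
  simp only [Commute, SemiconjBy, sepIdem, Finset.sum_mul, Finset.mul_sum,
    Algebra.TensorProduct.tmul_mul_tmul, mul_one, one_mul, src_tgt_comm]

/-- Passing t through L_{ac} and s through L_{cb} shifts by the same middle index c, and right
translation by c only permutes the summands of the idempotent. -/
lemma sepIdem_comm_genL (a b c : Q) : Commute (sepIdem K σ) (genL K σ a c ⊗ₜ genL K σ c b) := by
  simp only [Commute, SemiconjBy, sepIdem, Finset.sum_mul, Finset.mul_sum,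
    Algebra.TensorProduct.tmul_mul_tmul]
  refine Fintype.sum_bijective _ (mul_right_bijective' c) _ _ fun l => ?_
  rw [← tgt_mul_genL, ← src_mul_genL, shift_delta]

lemma sepIdem_comm_genLinv (a b c : Q) :
    Commute (sepIdem K σ) (genLinv K σ c b ⊗ₜ genLinv K σ a c) := by
  simp only [Commute, SemiconjBy, sepIdem, Finset.sum_mul, Finset.mul_sum,
    Algebra.TensorProduct.tmul_mul_tmul]
  refine (Fintype.sum_bijective _ (mul_right_bijective' c) _ _ fun l => ?_).symm
  rw [tgt_mul_genLinv, src_mul_genLinv, shift_delta]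

/-- `∑_c L_{ac} ⊗ L_{cb}` -/
def comulL (a b : Q) : FRTAlg K σ ⊗[K] FRTAlg K σ := ∑ c, genL K σ a c ⊗ₜ genL K σ c b

/-- `∑_c (L⁻¹)_{cb} ⊗ (L⁻¹)_{ac}` -/
def comulLinv (a b : Q) : FRTAlg K σ ⊗[K] FRTAlg K σ :=
  ∑ c, genLinv K σ c b ⊗ₜ genLinv K σ a c

lemma sepIdem_comm_comulL (a b : Q) : Commute (sepIdem K σ) (comulL K σ a b) :=
  Commute.sum_right _ _ _ fun c _ => sepIdem_comm_genL K σ a b c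

lemma sepIdem_comm_comulLinv (a b : Q) : Commute (sepIdem K σ) (comulLinv K σ a b) :=
  Commute.sum_right _ _ _ fun c _ => sepIdem_comm_genLinv K σ a b c

/-- The reversed legs in `comulLinv` bring L_{dc} and (L⁻¹)_{ce} together in the second factor.
Summing over c collapses that factor, and the remaining sum collapses the first. -/
lemma sum_comulL_comulLinv (a b : Q) :
    ∑ c, comulL K σ a c * comulLinv K σ c b = delta K a b • 1 := by
  have h : ∑ c, comulL K σ a c * comulLinv K σ c b =
      ∑ d, ∑ e, (genL K σ a d * genLinv K σ e b) ⊗ₜ (∑ c, genL K σ d c * genLinv K σ c e) := by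
    simp only [comulL, comulLinv, Finset.sum_mul_sum, Algebra.TensorProduct.tmul_mul_tmul,
      TensorProduct.tmul_sum]
    rw [Finset.sum_comm]
    exact Finset.sum_congr rfl fun d _ => Finset.sum_comm
  rw [h]
  simp_rw [sum_genL_genLinv, TensorProduct.tmul_smul, sum_delta_smul]
  rw [← TensorProduct.sum_tmul, sum_genL_genLinv, ← TensorProduct.smul_tmul']
  rfl

lemma sum_comulLinv_comulL (a b : Q) :
    ∑ c, comulLinv K σ a c * comulL K σ c b = delta K a b • 1 := by
  have h : ∑ c, comulLinv K σ a c * comulL K σ c b =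
      ∑ d, ∑ e, (∑ c, genLinv K σ d c * genL K σ c e) ⊗ₜ (genLinv K σ a d * genL K σ e b) := by
    simp only [comulL, comulLinv, Finset.sum_mul_sum, Algebra.TensorProduct.tmul_mul_tmul,
      TensorProduct.sum_tmul]
    rw [Finset.sum_comm]
    exact Finset.sum_congr rfl fun d _ => Finset.sum_comm
  rw [h]
  simp_rw [sum_genLinv_genL, ← TensorProduct.smul_tmul', sum_delta_smul]
  rw [← TensorProduct.tmul_sum, sum_genLinv_genL, TensorProduct.tmul_smul]
  rfl

lemma sum_four_comm {V : Type*} [AddCommMonoid V] (F : Q → Q → Q → Q → V) :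
    ∑ x, ∑ y, ∑ e, ∑ f, F x y e f = ∑ e, ∑ f, ∑ x, ∑ y, F x y e f := by
  rw [Finset.sum_congr rfl fun x _ => Finset.sum_comm, Finset.sum_comm]
  refine Finset.sum_congr rfl fun e _ => ?_
  rw [Finset.sum_congr rfl fun x _ => Finset.sum_comm, Finset.sum_comm]

/-- The exchange relation in the first leg turns the coefficient on the s-side into one on the
t-side. The idempotent carries it to the s-side of the second leg, where the exchange relation
applies again. -/
lemma comul_rll (a b c d : Q) :
    sepIdem K σ * ∑ x, ∑ y, (src K σ (sigmaCoeff K σ x y a c) ⊗ₜ 1) *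
        comulL K σ y d * comulL K σ x b =
      sepIdem K σ * ∑ x, ∑ y, (1 ⊗ₜ tgt K σ (sigmaCoeff K σ b d x y)) *
        comulL K σ c y * comulL K σ a x := by
  have h₁ : ∑ x, ∑ y, (src K σ (sigmaCoeff K σ x y a c) ⊗ₜ[K] (1 : FRTAlg K σ)) *
        comulL K σ y d * comulL K σ x b =
      ∑ e, ∑ f, (∑ x, ∑ y, src K σ (sigmaCoeff K σ x y a c) * genL K σ y e * genL K σ x f) ⊗ₜ
        (genL K σ e d * genL K σ f b) := by
    simp only [comulL, mul_assoc, Finset.sum_mul_sum]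
    simp only [Finset.mul_sum, Algebra.TensorProduct.tmul_mul_tmul, one_mul,
      TensorProduct.sum_tmul]
    rw [sum_four_comm]
  have h₂ : ∑ x, ∑ y, ((1 : FRTAlg K σ) ⊗ₜ[K] tgt K σ (sigmaCoeff K σ b d x y)) *
        comulL K σ c y * comulL K σ a x =
      ∑ y, ∑ x, (genL K σ c y * genL K σ a x) ⊗ₜ
        (∑ x', ∑ y', tgt K σ (sigmaCoeff K σ b d x' y') * genL K σ y y' * genL K σ x x') := by
    simp only [comulL, mul_assoc, Finset.sum_mul_sum]
    simp only [Finset.mul_sum, Algebra.TensorProduct.tmul_mul_tmul, one_mul,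
      TensorProduct.tmul_sum]
    rw [sum_four_comm]
  have h₃ : ∀ f v w, sepIdem K σ * ((tgt K σ f * v) ⊗ₜ w) =
      sepIdem K σ * (v ⊗ₜ (src K σ f * w)) := fun f v w => by
    have := congrArg (· * (v ⊗ₜ[K] w)) (sepIdem_mul_tgt K σ f)
    simpa [mul_assoc] using this
  rw [h₁, h₂]
  simp_rw [rll, ← rll K σ _ b _ d]
  simp only [Finset.mul_sum, TensorProduct.sum_tmul, TensorProduct.tmul_sum, h₃, mul_assoc]
  rw [sum_four_comm]
  rw [Finset.sum_comm]
  exact Finset.sum_congr rfl fun y _ => Finset.sum_congr rfl fun x _ => Finset.sum_comm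

/-- The map `f ↦ s(f) ⊗ 1`. -/
def srcLeft : (Q → K) →ₐ[K] FRTAlg K σ ⊗[K] FRTAlg K σ :=
  Algebra.TensorProduct.includeLeft.comp (src K σ)

/-- The map `f ↦ 1 ⊗ t(f)`. -/
def tgtRight : (Q → K) →ₐ[K] FRTAlg K σ ⊗[K] FRTAlg K σ :=
  Algebra.TensorProduct.includeRight.comp (tgt K σ)

lemma srcLeft_apply (f : Q → K) : srcLeft K σ f = src K σ f ⊗ₜ 1 := rfl

lemma tgtRight_apply (f : Q → K) : tgtRight K σ f = 1 ⊗ₜ tgt K σ f := rfl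

lemma sepIdem_comm_srcLeft (f : Q → K) : Commute (sepIdem K σ) (srcLeft K σ f) :=
  sepIdem_comm_src K σ f

lemma sepIdem_comm_tgtRight (f : Q → K) : Commute (sepIdem K σ) (tgtRight K σ f) :=
  sepIdem_comm_tgt K σ f

/-- The corner of `sepIdem`. -/
abbrev ComulCorner : Type _ :=
  CornerRing (B := FRTAlg K σ ⊗[K] FRTAlg K σ) (e := sepIdem K σ) (sepIdem_idem K σ)

/-- The coproduct as an algebra map to the corner of `sepIdem`. -/
def comulImage : FRTImage K σ (ComulCorner K σ) where
  u := cornerHom (sepIdem_idem K σ) (srcLeft K σ) (sepIdem_comm_srcLeft K σ)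
  v := cornerHom (sepIdem_idem K σ) (tgtRight K σ) (sepIdem_comm_tgtRight K σ)
  ℓ a b := cornerMk _ (comulL K σ a b) (sepIdem_comm_comulL K σ a b)
  ℓ' a b := cornerMk _ (comulLinv K σ a b) (sepIdem_comm_comulLinv K σ a b)
  comm f g := cornerVal_injective (k := K) _ (by
    simp only [cornerHom_apply, cornerMk_mul_cornerMk, cornerVal_cornerMk]
    simp [srcLeft_apply, tgtRight_apply])
  sum_ℓ_ℓ' a b := cornerVal_injective (k := K) _ (by
    simp only [cornerMk_mul_cornerMk, cornerVal_cornerMk, map_sum, ← Finset.mul_sum,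
      sum_comulL_comulLinv, map_smul, cornerVal_one, mul_smul_comm, mul_one])
  sum_ℓ'_ℓ a b := cornerVal_injective (k := K) _ (by
    simp only [cornerMk_mul_cornerMk, cornerVal_cornerMk, map_sum, ← Finset.mul_sum,
      sum_comulLinv_comulL, map_smul, cornerVal_one, mul_smul_comm, mul_one])
  u_ℓ f a b := cornerVal_injective (k := K) _ (by
    simp only [cornerHom_apply, cornerMk_mul_cornerMk, cornerVal_cornerMk]
    simp [srcLeft_apply, comulL, Finset.mul_sum, Finset.sum_mul, src_mul_genL])
  v_ℓ f a b := cornerVal_injective (k := K) _ (by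
    simp only [cornerHom_apply, cornerMk_mul_cornerMk, cornerVal_cornerMk]
    simp [tgtRight_apply, comulL, Finset.mul_sum, Finset.sum_mul, tgt_mul_genL])
  u_ℓ' f a b := cornerVal_injective (k := K) _ (by
    simp only [cornerHom_apply, cornerMk_mul_cornerMk, cornerVal_cornerMk]
    simp [srcLeft_apply, comulLinv, Finset.mul_sum, Finset.sum_mul, src_mul_genLinv])
  v_ℓ' f a b := cornerVal_injective (k := K) _ (by
    simp only [cornerHom_apply, cornerMk_mul_cornerMk, cornerVal_cornerMk]
    simp [tgtRight_apply, comulLinv, Finset.mul_sum, Finset.sum_mul, tgt_mul_genLinv])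
  rll a b c d := cornerVal_injective (k := K) _ (by
    simp only [cornerHom_apply, cornerMk_mul_cornerMk, cornerVal_cornerMk, map_sum,
      ← Finset.mul_sum]
    exact comul_rll K σ a b c d)

/-- The coproduct with values in `A_σ ⊗ A_σ`. -/
def comul : FRTAlg K σ →ₗ[K] FRTAlg K σ ⊗[K] FRTAlg K σ :=
  cornerVal K (sepIdem_idem K σ) ∘ₗ (comulImage K σ).lift.toLinearMap

lemma comul_mul (a b : FRTAlg K σ) : comul K σ (a * b) = comul K σ a * comul K σ b := by
  simp [comul]

lemma comul_one : comul K σ 1 = sepIdem K σ := by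
  simp [comul]

lemma comul_src (f : Q → K) : comul K σ (src K σ f) = sepIdem K σ * (src K σ f ⊗ₜ 1) := by
  simp [comul, comulImage, cornerHom_apply, srcLeft_apply]

lemma comul_tgt (f : Q → K) : comul K σ (tgt K σ f) = sepIdem K σ * (1 ⊗ₜ tgt K σ f) := by
  simp [comul, comulImage, cornerHom_apply, tgtRight_apply]

lemma comul_genL (a b : Q) : comul K σ (genL K σ a b) = sepIdem K σ * comulL K σ a b := by
  simp [comul, comulImage]

lemma comul_genLinv (a b : Q) : comul K σ (genLinv K σ a b) = sepIdem K σ * comulLinv K σ a b := by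
  simp [comul, comulImage]

lemma sepIdem_mul_comul (a : FRTAlg K σ) : sepIdem K σ * comul K σ a = comul K σ a := by
  rw [← comul_one, ← comul_mul, one_mul]

lemma comul_mul_sepIdem (a : FRTAlg K σ) : comul K σ a * sepIdem K σ = comul K σ a := by
  rw [← comul_one, ← comul_mul, mul_one]

lemma comul_src_mul (f : Q → K) (a : FRTAlg K σ) :
    comul K σ (src K σ f * a) = (src K σ f ⊗ₜ 1) * comul K σ a := by
  rw [comul_mul, comul_src, (sepIdem_comm_src K σ f).eq, mul_assoc, sepIdem_mul_comul]

lemma comul_tgt_mul (f : Q → K) (a : FRTAlg K σ) :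
    comul K σ (tgt K σ f * a) = (1 ⊗ₜ tgt K σ f) * comul K σ a := by
  rw [comul_mul, comul_tgt, (sepIdem_comm_tgt K σ f).eq, mul_assoc, sepIdem_mul_comul]

lemma comul_mul_src (f : Q → K) (a : FRTAlg K σ) :
    comul K σ (a * src K σ f) = comul K σ a * (src K σ f ⊗ₜ 1) := by
  rw [comul_mul, comul_src, ← mul_assoc, comul_mul_sepIdem]

lemma comul_mul_tgt (f : Q → K) (a : FRTAlg K σ) :
    comul K σ (a * tgt K σ f) = comul K σ a * (1 ⊗ₜ tgt K σ f) := by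
  rw [comul_mul, comul_tgt, ← mul_assoc, comul_mul_sepIdem]

lemma tgt_mul_comul (f : Q → K) (a : FRTAlg K σ) :
    (tgt K σ f ⊗ₜ 1) * comul K σ a = (1 ⊗ₜ src K σ f) * comul K σ a := by
  rw [← sepIdem_mul_comul, ← mul_assoc, tgt_mul_sepIdem, mul_assoc]

lemma comul_mul_tgt_left (f : Q → K) (a : FRTAlg K σ) :
    comul K σ a * (tgt K σ f ⊗ₜ 1) = comul K σ a * (1 ⊗ₜ src K σ f) := by
  rw [← comul_mul_sepIdem, mul_assoc, sepIdem_mul_tgt, mul_assoc]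

/-- Writing 1 = ∑_l 1 ⊗ s(e_l) and e_l = e_l e_l, the l-th difference t(e_l) ⊗ s(e_l) - 1 ⊗
s(e_l)s(e_l) is itself a balancing relation. -/
lemma sepIdem_sub_one_mem_left : sepIdem K σ - 1 ∈
    balanced (k := K) (fun f => LinearMap.mulLeft K (tgt K σ f))
      (fun f => LinearMap.mulLeft K (src K σ f)) := by
  have h : (1 : FRTAlg K σ ⊗[K] FRTAlg K σ) = ∑ l, 1 ⊗ₜ src K σ (delta K l) := by
    rw [← TensorProduct.tmul_sum, ← map_sum, sum_delta, map_one]; rfl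
  rw [h, sepIdem, ← Finset.sum_sub_distrib]
  refine Submodule.sum_mem _ fun l _ => Submodule.subset_span
    ⟨delta K l, 1, src K σ (delta K l), ?_⟩
  rw [LinearMap.mulLeft_apply, LinearMap.mulLeft_apply, mul_one, ← map_mul, delta_mul_self]

lemma sepIdem_sub_one_mem_right : sepIdem K σ - 1 ∈
    balanced (k := K) (fun f => LinearMap.mulRight K (tgt K σ f))
      (fun f => LinearMap.mulRight K (src K σ f)) := by
  have h : (1 : FRTAlg K σ ⊗[K] FRTAlg K σ) = ∑ l, 1 ⊗ₜ src K σ (delta K l) := by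
    rw [← TensorProduct.tmul_sum, ← map_sum, sum_delta, map_one]; rfl
  rw [h, sepIdem, ← Finset.sum_sub_distrib]
  refine Submodule.sum_mem _ fun l _ => Submodule.subset_span
    ⟨delta K l, 1, src K σ (delta K l), ?_⟩
  rw [LinearMap.mulRight_apply, LinearMap.mulRight_apply, one_mul, ← map_mul, delta_mul_self]

end Coproduct

/-! ### Coassociativity of the coproduct -/

section MulTensor

variable {k A : Type*} [CommRing k] [Ring A] [Algebra k A]

lemma assoc_mul (x y : (A ⊗[k] A) ⊗[k] A) :
    TensorProduct.assoc k A A A (x * y) =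
      TensorProduct.assoc k A A A x * TensorProduct.assoc k A A A y :=
  map_mul (Algebra.TensorProduct.assoc k k k A A A) x y

lemma rTensor_mul_of_map_mul (Δ : A →ₗ[k] A ⊗[k] A) (hΔ : ∀ a b, Δ (a * b) = Δ a * Δ b)
    (x y : A ⊗[k] A) : Δ.rTensor A (x * y) = Δ.rTensor A x * Δ.rTensor A y := by
  induction x with
  | zero => simp
  | add x x' hx hx' => simp only [add_mul, map_add, hx, hx']
  | tmul a b =>
    induction y with
    | zero => simp
    | add y y' hy hy' => simp only [mul_add, map_add, hy, hy']
    | tmul c d => simp [hΔ]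

lemma lTensor_mul_of_map_mul (Δ : A →ₗ[k] A ⊗[k] A) (hΔ : ∀ a b, Δ (a * b) = Δ a * Δ b)
    (x y : A ⊗[k] A) : Δ.lTensor A (x * y) = Δ.lTensor A x * Δ.lTensor A y := by
  induction x with
  | zero => simp
  | add x x' hx hx' => simp only [add_mul, map_add, hx, hx']
  | tmul a b =>
    induction y with
    | zero => simp
    | add y y' hy hy' => simp only [mul_add, map_add, hy, hy']
    | tmul c d => simp [hΔ]

end MulTensor

section Coassoc

variable (K : Type*) [Field K] {Q : Type*} [Mul Q] [IsQuasigroup Q] [Fintype Q]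
  (σ : Q → Q × Q → Q × Q)

/-- The map `Δ ⊗ id`. -/
def comulLeft : FRTAlg K σ ⊗[K] FRTAlg K σ →ₗ[K] FRTAlg K σ ⊗[K] (FRTAlg K σ ⊗[K] FRTAlg K σ) :=
  (TensorProduct.assoc K _ _ _).toLinearMap ∘ₗ (comul K σ).rTensor _

/-- The map `id ⊗ Δ`. -/
def comulRight : FRTAlg K σ ⊗[K] FRTAlg K σ →ₗ[K] FRTAlg K σ ⊗[K] (FRTAlg K σ ⊗[K] FRTAlg K σ) :=
  (comul K σ).lTensor _

lemma comulLeft_mul (x y : FRTAlg K σ ⊗[K] FRTAlg K σ) :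
    comulLeft K σ (x * y) = comulLeft K σ x * comulLeft K σ y := by
  simp only [comulLeft, LinearMap.comp_apply, LinearEquiv.coe_coe,
    rTensor_mul_of_map_mul _ (comul_mul K σ), assoc_mul]

lemma comulRight_mul (x y : FRTAlg K σ ⊗[K] FRTAlg K σ) :
    comulRight K σ (x * y) = comulRight K σ x * comulRight K σ y :=
  lTensor_mul_of_map_mul _ (comul_mul K σ) x y

lemma comulLeft_tmul (a b : FRTAlg K σ) :
    comulLeft K σ (a ⊗ₜ b) = TensorProduct.assoc K _ _ _ (comul K σ a ⊗ₜ b) := rfl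

lemma comulRight_tmul (a b : FRTAlg K σ) : comulRight K σ (a ⊗ₜ b) = a ⊗ₜ comul K σ b := rfl

/-- Both sides are ∑ t(e_m) ⊗ s(e_m)t(e_l) ⊗ s(e_l), the separability idempotent of the threefold
balanced product. -/
lemma comulLeft_sepIdem : comulLeft K σ (sepIdem K σ) = comulRight K σ (sepIdem K σ) := by
  have h₁ : comulLeft K σ (sepIdem K σ) = ∑ l, ∑ m, tgt K σ (delta K m) ⊗ₜ
      ((src K σ (delta K m) * tgt K σ (delta K l)) ⊗ₜ src K σ (delta K l)) := by
    conv_lhs => rw [sepIdem]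
    simp [comulLeft_tmul, comul_tgt, sepIdem, Finset.sum_mul, TensorProduct.sum_tmul]
  have h₂ : comulRight K σ (sepIdem K σ) = ∑ m, ∑ l, tgt K σ (delta K m) ⊗ₜ
      ((tgt K σ (delta K l) * src K σ (delta K m)) ⊗ₜ src K σ (delta K l)) := by
    conv_lhs => rw [sepIdem]
    simp [comulRight_tmul, comul_src, sepIdem, Finset.sum_mul, TensorProduct.tmul_sum]
  rw [h₁, h₂, Finset.sum_comm]
  simp only [src_tgt_comm]

/-- The threefold idempotent absorbs E ⊗ 1 = (Δ ⊗ id)(1 ⊗ 1). On generators, coassociativity is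
therefore reduced to comparing the sums without idempotents behind one common factor. -/
lemma comulLeft_sepIdem_mul (a b : FRTAlg K σ) (x : FRTAlg K σ ⊗[K] FRTAlg K σ)
    (h : comul K σ a = sepIdem K σ * x) :
    comulLeft K σ (sepIdem K σ * (a ⊗ₜ b)) =
      comulLeft K σ (sepIdem K σ) * TensorProduct.assoc K _ _ _ (x ⊗ₜ b) := by
  have e : (sepIdem K σ * x) ⊗ₜ[K] b = (sepIdem K σ ⊗ₜ 1) * (x ⊗ₜ b) := by simp
  have e' : comulLeft K σ (sepIdem K σ) * TensorProduct.assoc K _ _ _ (sepIdem K σ ⊗ₜ 1) =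
      comulLeft K σ (sepIdem K σ) := by
    rw [← comul_one, ← comulLeft_tmul, ← comulLeft_mul, ← Algebra.TensorProduct.one_def, mul_one]
  rw [comulLeft_mul, comulLeft_tmul, h, e, assoc_mul, ← mul_assoc, e']

lemma comulRight_sepIdem_mul (a b : FRTAlg K σ) (x : FRTAlg K σ ⊗[K] FRTAlg K σ)
    (h : comul K σ b = sepIdem K σ * x) :
    comulRight K σ (sepIdem K σ * (a ⊗ₜ b)) = comulRight K σ (sepIdem K σ) * (a ⊗ₜ x) := by
  have e : a ⊗ₜ[K] (sepIdem K σ * x) = (1 ⊗ₜ sepIdem K σ) * (a ⊗ₜ x) := by simp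
  have e' : comulRight K σ (sepIdem K σ) * (1 ⊗ₜ sepIdem K σ) = comulRight K σ (sepIdem K σ) := by
    rw [← comul_one, ← comulRight_tmul, ← comulRight_mul, ← Algebra.TensorProduct.one_def, mul_one]
  rw [comulRight_mul, comulRight_tmul, h, e, ← mul_assoc, e']

lemma comul_one' : comul K σ 1 = sepIdem K σ * 1 := by rw [comul_one, mul_one]

lemma comul_coassoc (a : FRTAlg K σ) :
    comulLeft K σ (comul K σ a) = comulRight K σ (comul K σ a) := by
  induction a using frt_induction with
  | hs f =>
    rw [comul_src, comulLeft_sepIdem_mul _ _ _ _ _ (comul_src K σ f),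
      comulRight_sepIdem_mul _ _ _ _ _ (comul_one' K σ), comulLeft_sepIdem]
    rfl
  | ht f =>
    rw [comul_tgt, comulLeft_sepIdem_mul _ _ _ _ _ (comul_one' K σ),
      comulRight_sepIdem_mul _ _ _ _ _ (comul_tgt K σ f), comulLeft_sepIdem]
    rfl
  | hL a b =>
    rw [comul_genL, comulL, Finset.mul_sum, map_sum, map_sum]
    simp_rw [comulLeft_sepIdem_mul _ _ _ _ _ (comul_genL K σ _ _),
      comulRight_sepIdem_mul _ _ _ _ _ (comul_genL K σ _ _), comulLeft_sepIdem, ← Finset.mul_sum,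
      comulL, TensorProduct.sum_tmul, TensorProduct.tmul_sum, map_sum, TensorProduct.assoc_tmul]
    rw [Finset.sum_comm]
  | hL' a b =>
    rw [comul_genLinv, comulLinv, Finset.mul_sum, map_sum, map_sum]
    simp_rw [comulLeft_sepIdem_mul _ _ _ _ _ (comul_genLinv K σ _ _),
      comulRight_sepIdem_mul _ _ _ _ _ (comul_genLinv K σ _ _), comulLeft_sepIdem,
      ← Finset.mul_sum, comulLinv, TensorProduct.sum_tmul, TensorProduct.tmul_sum, map_sum,
      TensorProduct.assoc_tmul]
    rw [Finset.sum_comm]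
  | hadd a b ha hb => rw [map_add, map_add, map_add, ha, hb]
  | hmul a b ha hb => rw [comul_mul, comulLeft_mul, comulRight_mul, ha, hb]

end Coassoc

/-! ### The representation of A_σ on functions on Q -/

section Counit

open scoped Classical

variable (K : Type*) [Field K] {Q : Type*} [Mul Q] [IsQuasigroup Q] [Fintype Q]

/-- The matrix of the shift `T_a`. -/
def shiftMat (a : Q) : Matrix Q Q K := Matrix.of fun l m => delta K (l * a) m

lemma shiftMat_mul (a : Q) (N : Matrix Q Q K) (l m : Q) :
    (shiftMat K a * N) l m = N (l * a) m := by
  simpa [Matrix.mul_apply, shiftMat] using sum_delta_smul K (l * a) (fun n => N n m)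

lemma shiftMat_mulVec (a : Q) (f : Q → K) : (shiftMat K a).mulVec f = shift a f := by
  ext l
  simpa [Matrix.mulVec, dotProduct, shiftMat, shift] using sum_delta_smul K (l * a) f

lemma transpose_mulVec_shift (a : Q) (f : Q → K) :
    (shiftMat K a).transpose.mulVec (shift a f) = f := by
  ext m
  obtain ⟨l, rfl⟩ := (mul_right_bijective' a).2 m
  simp only [Matrix.mulVec, dotProduct, Matrix.transpose_apply, shiftMat, Matrix.of_apply]
  rw [Finset.sum_eq_single l]
  · simp [delta, shift]
  · intro n _ h
    have : n * a ≠ l * a := fun e => h ((mul_right_bijective' a).1 e)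
    simp [delta, this]
  · simp

lemma shiftMat_mul_transpose (a : Q) : shiftMat K a * (shiftMat K a).transpose = 1 := by
  ext l m
  rw [shiftMat_mul, Matrix.transpose_apply, shiftMat, Matrix.of_apply, Matrix.one_apply]
  by_cases h : l = m
  · simp [delta, h]
  · have : m * a ≠ l * a := fun e => h ((mul_right_bijective' a).1 e).symm
    simp [delta, h, this]

lemma transpose_mul_shiftMat (a : Q) : (shiftMat K a).transpose * shiftMat K a = 1 :=
  mul_eq_one_comm.1 (shiftMat_mul_transpose K a)

lemma diagonal_mul_shiftMat (f : Q → K) (a : Q) :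
    Matrix.diagonal (shift a f) * shiftMat K a = shiftMat K a * Matrix.diagonal f := by
  ext l m
  rw [Matrix.diagonal_mul, Matrix.mul_diagonal, shiftMat, Matrix.of_apply]
  by_cases h : l * a = m
  · simp [delta, h, shift]
  · simp [delta, h]

lemma diagonal_mul_transpose (f : Q → K) (a : Q) :
    Matrix.diagonal f * (shiftMat K a).transpose =
      (shiftMat K a).transpose * Matrix.diagonal (shift a f) := by
  have h := congrArg Matrix.transpose (diagonal_mul_shiftMat K f a)
  simpa using h.symm

variable {K} in
-- Row l of the two products of shifts is supported at (ld)b and at (lc)a respectively. The diagonal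
-- factor keeps only those l for which σ(l)(b,d) = (a,c), where the two endpoints agree.
lemma diagonal_sigmaCoeff_mul {σ : Q → Q × Q → Q × Q}
    (hσ : ∀ l x y a c, σ l (x, y) = (a, c) → (l * c) * a = (l * y) * x) (a b c d : Q) :
    Matrix.diagonal (sigmaCoeff K σ b d a c) * shiftMat K d * shiftMat K b =
      Matrix.diagonal (sigmaCoeff K σ b d a c) * shiftMat K c * shiftMat K a := by
  ext l m
  rw [mul_assoc, mul_assoc, Matrix.diagonal_mul, Matrix.diagonal_mul, shiftMat_mul, shiftMat_mul]
  by_cases h : σ l (b, d) = (a, c)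
  · simp [shiftMat, hσ _ _ _ _ _ h]
  · simp [sigmaCoeff, h]

variable {σ : Q → Q × Q → Q × Q}
  (hσ : ∀ l x y a c, σ l (x, y) = (a, c) → (l * c) * a = (l * y) * x)

/-- The action of `A_σ` on functions on `Q`. -/
def matImage : FRTImage K σ (Matrix Q Q K) where
  u := Matrix.diagonalAlgHom K
  v := Matrix.diagonalAlgHom K
  comm f g := by
    change Matrix.diagonal f * Matrix.diagonal g = Matrix.diagonal g * Matrix.diagonal f
    simp [mul_comm]
  ℓ a b := delta K a b • shiftMat K a
  ℓ' a b := delta K a b • (shiftMat K a).transpose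
  sum_ℓ_ℓ' a b := by
    simp_rw [smul_mul_assoc, sum_delta_smul, mul_smul_comm, shiftMat_mul_transpose]
  sum_ℓ'_ℓ a b := by
    simp_rw [smul_mul_assoc, sum_delta_smul, mul_smul_comm, transpose_mul_shiftMat]
  u_ℓ f a b := by
    simpa using congrArg (delta K a b • ·) (diagonal_mul_shiftMat K f a)
  v_ℓ f a b := by
    -- This relation shifts by the second index while the matrix shifts by the first; the factor
    -- δ_{ab} reconciles them.
    by_cases h : a = b
    · subst h
      simpa using congrArg (delta K a a • ·) (diagonal_mul_shiftMat K f a)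
    · simp [delta, h]
  u_ℓ' f a b := by
    by_cases h : a = b
    · subst h
      simpa using congrArg (delta K a a • ·) (diagonal_mul_transpose K f a)
    · simp [delta, h]
  v_ℓ' f a b := by
    simpa using congrArg (delta K a b • ·) (diagonal_mul_transpose K f a)
  rll a b c d := by
    have h (N N₁ N₂ : Matrix Q Q K) (α β : K) :
        N * (α • N₁) * (β • N₂) = β • α • (N * N₁ * N₂) := by
      rw [mul_smul_comm, mul_smul_comm, smul_mul_assoc]
    simp_rw [Matrix.diagonalAlgHom_apply, h, ← Finset.smul_sum, delta_comm K _ d, delta_comm K _ b,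
      sum_delta_smul]
    exact diagonal_sigmaCoeff_mul hσ a b c d

/-- The representation of `A_σ` on functions on `Q`. -/
def matRep : FRTAlg K σ →ₐ[K] Matrix Q Q K := (matImage K hσ).lift

@[simp] lemma matRep_src (f : Q → K) : matRep K hσ (src K σ f) = Matrix.diagonal f :=
  FRTImage.lift_src _ f

@[simp] lemma matRep_tgt (f : Q → K) : matRep K hσ (tgt K σ f) = Matrix.diagonal f :=
  FRTImage.lift_tgt _ f

@[simp] lemma matRep_genL (a b : Q) :
    matRep K hσ (genL K σ a b) = delta K a b • shiftMat K a :=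
  FRTImage.lift_genL _ a b

@[simp] lemma matRep_genLinv (a b : Q) :
    matRep K hσ (genLinv K σ a b) = delta K a b • (shiftMat K a).transpose :=
  FRTImage.lift_genLinv _ a b

end Counit

/-! ### The two counits and the counit axioms -/

section Counit

open scoped Classical

variable (K : Type*) [Field K] {Q : Type*} [Mul Q] [IsQuasigroup Q] [Fintype Q]
  {σ : Q → Q × Q → Q × Q} (hσ : ∀ l x y a c, σ l (x, y) = (a, c) → (l * c) * a = (l * y) * x)

/-- The left counit `a ↦ a · 1`. -/
def counitL : FRTAlg K σ →ₗ[K] (Q → K) where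
  toFun a := (matRep K hσ a).mulVec 1
  map_add' a b := by rw [map_add, Matrix.add_mulVec]
  map_smul' c a := by rw [map_smul, Matrix.smul_mulVec, RingHom.id_apply]

/-- The right counit `a ↦ 1 · a`. -/
def counitR : FRTAlg K σ →ₗ[K] (Q → K) where
  toFun a := Matrix.vecMul 1 (matRep K hσ a)
  map_add' a b := by rw [map_add, Matrix.vecMul_add]
  map_smul' c a := by rw [map_smul, Matrix.vecMul_smul, RingHom.id_apply]

lemma counitL_apply (a : FRTAlg K σ) : counitL K hσ a = (matRep K hσ a).mulVec 1 := rfl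

lemma counitR_apply (a : FRTAlg K σ) : counitR K hσ a = Matrix.vecMul 1 (matRep K hσ a) := rfl

lemma diagonal_mulVec_eq (f g : Q → K) : (Matrix.diagonal f).mulVec g = f * g := by
  ext l; simp [Matrix.mulVec_diagonal]

lemma vecMul_diagonal_eq (f g : Q → K) : Matrix.vecMul g (Matrix.diagonal f) = g * f := by
  ext l; simp [Matrix.vecMul_diagonal]

lemma counitL_one : counitL K hσ 1 = 1 := by simp [counitL_apply]

lemma counitR_one : counitR K hσ 1 = 1 := by simp [counitR_apply]

lemma counitL_mul (a b : FRTAlg K σ) :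
    counitL K hσ (a * b) = (matRep K hσ a).mulVec (counitL K hσ b) := by
  simp [counitL_apply]

lemma counitR_mul (a b : FRTAlg K σ) :
    counitR K hσ (a * b) = Matrix.vecMul (counitR K hσ a) (matRep K hσ b) := by
  simp [counitR_apply]

lemma counitL_src (f : Q → K) : counitL K hσ (src K σ f) = f := by
  simp [counitL_apply, diagonal_mulVec_eq]

lemma counitL_tgt (f : Q → K) : counitL K hσ (tgt K σ f) = f := by
  simp [counitL_apply, diagonal_mulVec_eq]

lemma counitR_src (f : Q → K) : counitR K hσ (src K σ f) = f := by
  simp [counitR_apply, vecMul_diagonal_eq]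

lemma counitR_tgt (f : Q → K) : counitR K hσ (tgt K σ f) = f := by
  simp [counitR_apply, vecMul_diagonal_eq]

lemma shiftMat_mulVec_one (a : Q) : (shiftMat K a).mulVec (1 : Q → K) = 1 :=
  shiftMat_mulVec K a 1

lemma transpose_mulVec_one (a : Q) : (shiftMat K a).transpose.mulVec (1 : Q → K) = 1 :=
  transpose_mulVec_shift K a 1

lemma counitL_genL (a b : Q) : counitL K hσ (genL K σ a b) = delta K a b • 1 := by
  rw [counitL_apply, matRep_genL, Matrix.smul_mulVec, shiftMat_mulVec_one]

lemma counitL_genLinv (a b : Q) : counitL K hσ (genLinv K σ a b) = delta K a b • 1 := by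
  rw [counitL_apply, matRep_genLinv, Matrix.smul_mulVec, transpose_mulVec_one]

lemma counitR_genL (a b : Q) : counitR K hσ (genL K σ a b) = delta K a b • 1 := by
  rw [counitR_apply, matRep_genL, Matrix.vecMul_smul, ← Matrix.mulVec_transpose,
    transpose_mulVec_one]

lemma counitR_genLinv (a b : Q) : counitR K hσ (genLinv K σ a b) = delta K a b • 1 := by
  rw [counitR_apply, matRep_genLinv, Matrix.vecMul_smul, Matrix.vecMul_transpose,
    shiftMat_mulVec_one]

lemma counitL_src_mul (f : Q → K) (a : FRTAlg K σ) :
    counitL K hσ (src K σ f * a) = f * counitL K hσ a := by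
  rw [counitL_mul, matRep_src, diagonal_mulVec_eq]

lemma counitL_tgt_mul (f : Q → K) (a : FRTAlg K σ) :
    counitL K hσ (tgt K σ f * a) = f * counitL K hσ a := by
  rw [counitL_mul, matRep_tgt, diagonal_mulVec_eq]

lemma counitR_mul_src (f : Q → K) (a : FRTAlg K σ) :
    counitR K hσ (a * src K σ f) = counitR K hσ a * f := by
  rw [counitR_mul, matRep_src, vecMul_diagonal_eq]

lemma counitR_mul_tgt (f : Q → K) (a : FRTAlg K σ) :
    counitR K hσ (a * tgt K σ f) = counitR K hσ a * f := by
  rw [counitR_mul, matRep_tgt, vecMul_diagonal_eq]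

/-- Both s(f) and t(f) send the constant function 1 to f, so either one may replace `b` when only
the action of `b` on 1 matters. -/
lemma counitL_mul_src_counitL (a b : FRTAlg K σ) :
    counitL K hσ (a * src K σ (counitL K hσ b)) = counitL K hσ (a * b) := by
  rw [counitL_mul, counitL_src, counitL_mul]

lemma counitL_mul_tgt_counitL (a b : FRTAlg K σ) :
    counitL K hσ (a * tgt K σ (counitL K hσ b)) = counitL K hσ (a * b) := by
  rw [counitL_mul, counitL_tgt, counitL_mul]

lemma counitR_src_counitR_mul (a b : FRTAlg K σ) :
    counitR K hσ (src K σ (counitR K hσ a) * b) = counitR K hσ (a * b) := by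
  rw [counitR_mul, counitR_src, counitR_mul]

lemma counitR_tgt_counitR_mul (a b : FRTAlg K σ) :
    counitR K hσ (tgt K σ (counitR K hσ a) * b) = counitR K hσ (a * b) := by
  rw [counitR_mul, counitR_tgt, counitR_mul]

/-- Two linear maps on a tensor product that agree on pure tensors take equal values. -/
lemma tensor_congr {V : Type*} [AddCommMonoid V] [Module K V]
    {F G : FRTAlg K σ ⊗[K] FRTAlg K σ →ₗ[K] V} (h : ∀ x y, F (x ⊗ₜ y) = G (x ⊗ₜ y))
    (z : FRTAlg K σ ⊗[K] FRTAlg K σ) : F z = G z :=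
  LinearMap.congr_fun (TensorProduct.ext' h) z

section LeftLeft

/-- `x ⊗ y ↦ s(π_L(x)) y` -/
def contractLL : FRTAlg K σ ⊗[K] FRTAlg K σ →ₗ[K] FRTAlg K σ :=
  LinearMap.mul' K _ ∘ₗ TensorProduct.map ((src K σ).toLinearMap ∘ₗ counitL K hσ) LinearMap.id

lemma contractLL_tmul (x y : FRTAlg K σ) :
    contractLL K hσ (x ⊗ₜ y) = src K σ (counitL K hσ x) * y := rfl

lemma contractLL_mul_tmul (z : FRTAlg K σ ⊗[K] FRTAlg K σ) (x y : FRTAlg K σ) :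
    contractLL K hσ (z * (x ⊗ₜ y)) =
      contractLL K hσ (z * (tgt K σ (counitL K hσ x) ⊗ₜ 1)) * y := by
  refine tensor_congr K (F := contractLL K hσ ∘ₗ LinearMap.mulRight K (x ⊗ₜ y))
    (G := LinearMap.mulRight K y ∘ₗ contractLL K hσ ∘ₗ LinearMap.mulRight K _) (fun a b => ?_) z
  simp [contractLL_tmul, counitL_mul_tgt_counitL, mul_assoc]

lemma contractLL_mul_one_tmul (z : FRTAlg K σ ⊗[K] FRTAlg K σ) (y : FRTAlg K σ) :
    contractLL K hσ (z * (1 ⊗ₜ y)) = contractLL K hσ z * y := by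
  refine tensor_congr K (F := contractLL K hσ ∘ₗ LinearMap.mulRight K (1 ⊗ₜ y))
    (G := LinearMap.mulRight K y ∘ₗ contractLL K hσ) (fun a b => ?_) z
  simp [contractLL_tmul, mul_assoc]

/-- A left factor x of z enters only through t(π_L(x)) ⊗ 1, which `comul K σ a` converts into 1 ⊗
s(π_L(x)). Hence contraction after the coproduct is multiplicative, and the counit axiom need only
be checked on generators. -/
lemma contractLL_comul_mul (a : FRTAlg K σ) (z : FRTAlg K σ ⊗[K] FRTAlg K σ) :
    contractLL K hσ (comul K σ a * z) = contractLL K hσ (comul K σ a) * contractLL K hσ z := by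
  refine tensor_congr K (F := contractLL K hσ ∘ₗ LinearMap.mulLeft K (comul K σ a))
    (G := LinearMap.mulLeft K (contractLL K hσ (comul K σ a)) ∘ₗ contractLL K hσ) (fun x y => ?_) z
  simp only [LinearMap.comp_apply, LinearMap.mulLeft_apply]
  rw [contractLL_mul_tmul, comul_mul_tgt_left, contractLL_mul_one_tmul, contractLL_tmul, mul_assoc]

/-- The contraction is balanced: the l-th summand contributes e_l twice to the same function, and
the e_l sum to 1. So E can be dropped from the coproducts of generators. -/
lemma contractLL_sepIdem_mul (z : FRTAlg K σ ⊗[K] FRTAlg K σ) :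
    contractLL K hσ (sepIdem K σ * z) = contractLL K hσ z := by
  refine tensor_congr K (F := contractLL K hσ ∘ₗ LinearMap.mulLeft K (sepIdem K σ))
    (G := contractLL K hσ) (fun x y => ?_) z
  simp only [LinearMap.comp_apply, LinearMap.mulLeft_apply, sepIdem, Finset.sum_mul,
    Algebra.TensorProduct.tmul_mul_tmul, map_sum, contractLL_tmul, counitL_tgt_mul]
  simp_rw [← mul_assoc, ← map_mul, mul_comm (delta K _), mul_assoc, delta_mul_self]
  rw [← Finset.sum_mul, ← map_sum, ← Finset.mul_sum, sum_delta, mul_one]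

lemma contractLL_comul (a : FRTAlg K σ) : contractLL K hσ (comul K σ a) = a := by
  induction a using frt_induction with
  | hs f => simp [comul_src, contractLL_sepIdem_mul, contractLL_tmul, counitL_src]
  | ht f => simp [comul_tgt, contractLL_sepIdem_mul, contractLL_tmul, counitL_one]
  | hL a b =>
    simp [comul_genL, contractLL_sepIdem_mul, comulL, contractLL_tmul, counitL_genL,
      sum_delta_smul]
  | hL' a b =>
    simp [comul_genLinv, contractLL_sepIdem_mul, comulLinv, contractLL_tmul, counitL_genLinv,
      delta_comm K _ b, sum_delta_smul]
  | hadd a b ha hb => rw [map_add, map_add, ha, hb]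
  | hmul a b ha hb => rw [comul_mul, contractLL_comul_mul, ha, hb]

end LeftLeft

section LeftRight

/-- `x ⊗ y ↦ t(π_L(y)) x` -/
def contractLR : FRTAlg K σ ⊗[K] FRTAlg K σ →ₗ[K] FRTAlg K σ :=
  LinearMap.mul' K _ ∘ₗ TensorProduct.map ((tgt K σ).toLinearMap ∘ₗ counitL K hσ) LinearMap.id ∘ₗ
    (TensorProduct.comm K _ _).toLinearMap

lemma contractLR_tmul (x y : FRTAlg K σ) :
    contractLR K hσ (x ⊗ₜ y) = tgt K σ (counitL K hσ y) * x := rfl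

lemma contractLR_mul_tmul (z : FRTAlg K σ ⊗[K] FRTAlg K σ) (x y : FRTAlg K σ) :
    contractLR K hσ (z * (x ⊗ₜ y)) =
      contractLR K hσ (z * (1 ⊗ₜ src K σ (counitL K hσ y))) * x := by
  refine tensor_congr K (F := contractLR K hσ ∘ₗ LinearMap.mulRight K (x ⊗ₜ y))
    (G := LinearMap.mulRight K x ∘ₗ contractLR K hσ ∘ₗ LinearMap.mulRight K _) (fun a b => ?_) z
  simp [contractLR_tmul, counitL_mul_src_counitL, mul_assoc]

lemma contractLR_mul_tmul_one (z : FRTAlg K σ ⊗[K] FRTAlg K σ) (x : FRTAlg K σ) :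
    contractLR K hσ (z * (x ⊗ₜ 1)) = contractLR K hσ z * x := by
  refine tensor_congr K (F := contractLR K hσ ∘ₗ LinearMap.mulRight K (x ⊗ₜ 1))
    (G := LinearMap.mulRight K x ∘ₗ contractLR K hσ) (fun a b => ?_) z
  simp [contractLR_tmul, mul_assoc]

lemma contractLR_comul_mul (a : FRTAlg K σ) (z : FRTAlg K σ ⊗[K] FRTAlg K σ) :
    contractLR K hσ (comul K σ a * z) = contractLR K hσ (comul K σ a) * contractLR K hσ z := by
  refine tensor_congr K (F := contractLR K hσ ∘ₗ LinearMap.mulLeft K (comul K σ a))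
    (G := LinearMap.mulLeft K (contractLR K hσ (comul K σ a)) ∘ₗ contractLR K hσ) (fun x y => ?_) z
  simp only [LinearMap.comp_apply, LinearMap.mulLeft_apply]
  rw [contractLR_mul_tmul, ← comul_mul_tgt_left, contractLR_mul_tmul_one, contractLR_tmul,
    mul_assoc]

lemma contractLR_sepIdem_mul (z : FRTAlg K σ ⊗[K] FRTAlg K σ) :
    contractLR K hσ (sepIdem K σ * z) = contractLR K hσ z := by
  refine tensor_congr K (F := contractLR K hσ ∘ₗ LinearMap.mulLeft K (sepIdem K σ))
    (G := contractLR K hσ) (fun x y => ?_) z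
  simp only [LinearMap.comp_apply, LinearMap.mulLeft_apply, sepIdem, Finset.sum_mul,
    Algebra.TensorProduct.tmul_mul_tmul, map_sum, contractLR_tmul, counitL_src_mul]
  simp_rw [← mul_assoc, ← map_mul, mul_comm (delta K _), mul_assoc, delta_mul_self]
  rw [← Finset.sum_mul, ← map_sum, ← Finset.mul_sum, sum_delta, mul_one]

lemma contractLR_comul (a : FRTAlg K σ) : contractLR K hσ (comul K σ a) = a := by
  induction a using frt_induction with
  | hs f => simp [comul_src, contractLR_sepIdem_mul, contractLR_tmul, counitL_one]
  | ht f => simp [comul_tgt, contractLR_sepIdem_mul, contractLR_tmul, counitL_tgt]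
  | hL a b =>
    simp [comul_genL, contractLR_sepIdem_mul, comulL, contractLR_tmul, counitL_genL,
      delta_comm K _ b, sum_delta_smul]
  | hL' a b =>
    simp [comul_genLinv, contractLR_sepIdem_mul, comulLinv, contractLR_tmul, counitL_genLinv,
      sum_delta_smul]
  | hadd a b ha hb => rw [map_add, map_add, ha, hb]
  | hmul a b ha hb => rw [comul_mul, contractLR_comul_mul, ha, hb]

end LeftRight

section RightRight

/-- `x ⊗ y ↦ x t(π_R(y))` -/
def contractRR : FRTAlg K σ ⊗[K] FRTAlg K σ →ₗ[K] FRTAlg K σ :=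
  LinearMap.mul' K _ ∘ₗ TensorProduct.map LinearMap.id ((tgt K σ).toLinearMap ∘ₗ counitR K hσ)

lemma contractRR_tmul (x y : FRTAlg K σ) :
    contractRR K hσ (x ⊗ₜ y) = x * tgt K σ (counitR K hσ y) := rfl

lemma contractRR_tmul_mul (z : FRTAlg K σ ⊗[K] FRTAlg K σ) (x y : FRTAlg K σ) :
    contractRR K hσ ((x ⊗ₜ y) * z) =
      x * contractRR K hσ ((1 ⊗ₜ src K σ (counitR K hσ y)) * z) := by
  refine tensor_congr K (F := contractRR K hσ ∘ₗ LinearMap.mulLeft K (x ⊗ₜ y))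
    (G := LinearMap.mulLeft K x ∘ₗ contractRR K hσ ∘ₗ LinearMap.mulLeft K _) (fun a b => ?_) z
  simp [contractRR_tmul, counitR_src_counitR_mul, mul_assoc]

lemma contractRR_tmul_one_mul (z : FRTAlg K σ ⊗[K] FRTAlg K σ) (x : FRTAlg K σ) :
    contractRR K hσ ((x ⊗ₜ 1) * z) = x * contractRR K hσ z := by
  refine tensor_congr K (F := contractRR K hσ ∘ₗ LinearMap.mulLeft K (x ⊗ₜ 1))
    (G := LinearMap.mulLeft K x ∘ₗ contractRR K hσ) (fun a b => ?_) z
  simp [contractRR_tmul, mul_assoc]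

/-- Mirror image of the left case: the coproduct stands on the right, and its left balancing
property moves s(π_R(y)) from the second leg to t(π_R(y)) in the first. -/
lemma contractRR_mul_comul (a : FRTAlg K σ) (z : FRTAlg K σ ⊗[K] FRTAlg K σ) :
    contractRR K hσ (z * comul K σ a) = contractRR K hσ z * contractRR K hσ (comul K σ a) := by
  refine tensor_congr K (F := contractRR K hσ ∘ₗ LinearMap.mulRight K (comul K σ a))
    (G := LinearMap.mulRight K (contractRR K hσ (comul K σ a)) ∘ₗ contractRR K hσ) (fun x y => ?_) z
  simp only [LinearMap.comp_apply, LinearMap.mulRight_apply]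
  rw [contractRR_tmul_mul, ← tgt_mul_comul, contractRR_tmul_one_mul, contractRR_tmul, mul_assoc]

lemma contractRR_mul_sepIdem (z : FRTAlg K σ ⊗[K] FRTAlg K σ) :
    contractRR K hσ (z * sepIdem K σ) = contractRR K hσ z := by
  refine tensor_congr K (F := contractRR K hσ ∘ₗ LinearMap.mulRight K (sepIdem K σ))
    (G := contractRR K hσ) (fun x y => ?_) z
  simp only [LinearMap.comp_apply, LinearMap.mulRight_apply, sepIdem, Finset.mul_sum,
    Algebra.TensorProduct.tmul_mul_tmul, map_sum, contractRR_tmul, counitR_mul_src]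
  simp_rw [mul_assoc, ← map_mul, mul_comm _ (delta K _), ← mul_assoc, delta_mul_self]
  rw [← Finset.mul_sum, ← map_sum, ← Finset.sum_mul, sum_delta, one_mul]

lemma contractRR_comul (a : FRTAlg K σ) : contractRR K hσ (comul K σ a) = a := by
  induction a using frt_induction with
  | hs f =>
    rw [comul_src, (sepIdem_comm_src K σ f).eq, contractRR_mul_sepIdem]
    simp [contractRR_tmul, counitR_one]
  | ht f =>
    rw [comul_tgt, (sepIdem_comm_tgt K σ f).eq, contractRR_mul_sepIdem]
    simp [contractRR_tmul, counitR_tgt]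
  | hL a b =>
    rw [comul_genL, (sepIdem_comm_comulL K σ a b).eq, contractRR_mul_sepIdem]
    simp [comulL, contractRR_tmul, counitR_genL, delta_comm K _ b, sum_delta_smul]
  | hL' a b =>
    rw [comul_genLinv, (sepIdem_comm_comulLinv K σ a b).eq, contractRR_mul_sepIdem]
    simp [comulLinv, contractRR_tmul, counitR_genLinv, sum_delta_smul]
  | hadd a b ha hb => rw [map_add, map_add, ha, hb]
  | hmul a b ha hb => rw [comul_mul, contractRR_mul_comul, ha, hb]

end RightRight

section RightLeft

/-- `x ⊗ y ↦ y s(π_R(x))` -/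
def contractRL : FRTAlg K σ ⊗[K] FRTAlg K σ →ₗ[K] FRTAlg K σ :=
  LinearMap.mul' K _ ∘ₗ TensorProduct.map LinearMap.id ((src K σ).toLinearMap ∘ₗ counitR K hσ) ∘ₗ
    (TensorProduct.comm K _ _).toLinearMap

lemma contractRL_tmul (x y : FRTAlg K σ) :
    contractRL K hσ (x ⊗ₜ y) = y * src K σ (counitR K hσ x) := rfl

lemma contractRL_tmul_mul (z : FRTAlg K σ ⊗[K] FRTAlg K σ) (x y : FRTAlg K σ) :
    contractRL K hσ ((x ⊗ₜ y) * z) =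
      y * contractRL K hσ ((tgt K σ (counitR K hσ x) ⊗ₜ 1) * z) := by
  refine tensor_congr K (F := contractRL K hσ ∘ₗ LinearMap.mulLeft K (x ⊗ₜ y))
    (G := LinearMap.mulLeft K y ∘ₗ contractRL K hσ ∘ₗ LinearMap.mulLeft K _) (fun a b => ?_) z
  simp [contractRL_tmul, counitR_tgt_counitR_mul, mul_assoc]

lemma contractRL_one_tmul_mul (z : FRTAlg K σ ⊗[K] FRTAlg K σ) (y : FRTAlg K σ) :
    contractRL K hσ ((1 ⊗ₜ y) * z) = y * contractRL K hσ z := by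
  refine tensor_congr K (F := contractRL K hσ ∘ₗ LinearMap.mulLeft K (1 ⊗ₜ y))
    (G := LinearMap.mulLeft K y ∘ₗ contractRL K hσ) (fun a b => ?_) z
  simp [contractRL_tmul, mul_assoc]

lemma contractRL_mul_comul (a : FRTAlg K σ) (z : FRTAlg K σ ⊗[K] FRTAlg K σ) :
    contractRL K hσ (z * comul K σ a) = contractRL K hσ z * contractRL K hσ (comul K σ a) := by
  refine tensor_congr K (F := contractRL K hσ ∘ₗ LinearMap.mulRight K (comul K σ a))
    (G := LinearMap.mulRight K (contractRL K hσ (comul K σ a)) ∘ₗ contractRL K hσ) (fun x y => ?_) z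
  simp only [LinearMap.comp_apply, LinearMap.mulRight_apply]
  rw [contractRL_tmul_mul, tgt_mul_comul, contractRL_one_tmul_mul, contractRL_tmul, mul_assoc]

lemma contractRL_mul_sepIdem (z : FRTAlg K σ ⊗[K] FRTAlg K σ) :
    contractRL K hσ (z * sepIdem K σ) = contractRL K hσ z := by
  refine tensor_congr K (F := contractRL K hσ ∘ₗ LinearMap.mulRight K (sepIdem K σ))
    (G := contractRL K hσ) (fun x y => ?_) z
  simp only [LinearMap.comp_apply, LinearMap.mulRight_apply, sepIdem, Finset.mul_sum,
    Algebra.TensorProduct.tmul_mul_tmul, map_sum, contractRL_tmul, counitR_mul_tgt]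
  simp_rw [mul_assoc, ← map_mul, mul_comm _ (delta K _), ← mul_assoc, delta_mul_self]
  rw [← Finset.mul_sum, ← map_sum, ← Finset.sum_mul, sum_delta, one_mul]

lemma contractRL_comul (a : FRTAlg K σ) : contractRL K hσ (comul K σ a) = a := by
  induction a using frt_induction with
  | hs f =>
    rw [comul_src, (sepIdem_comm_src K σ f).eq, contractRL_mul_sepIdem]
    simp [contractRL_tmul, counitR_src]
  | ht f =>
    rw [comul_tgt, (sepIdem_comm_tgt K σ f).eq, contractRL_mul_sepIdem]
    simp [contractRL_tmul, counitR_one]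
  | hL a b =>
    rw [comul_genL, (sepIdem_comm_comulL K σ a b).eq, contractRL_mul_sepIdem]
    simp [comulL, contractRL_tmul, counitR_genL, sum_delta_smul]
  | hL' a b =>
    rw [comul_genLinv, (sepIdem_comm_comulLinv K σ a b).eq, contractRL_mul_sepIdem]
    simp [comulLinv, contractRL_tmul, counitR_genLinv, delta_comm K _ b, sum_delta_smul]
  | hadd a b ha hb => rw [map_add, map_add, ha, hb]
  | hmul a b ha hb => rw [comul_mul, contractRL_mul_comul, ha, hb]

end RightLeft

end Counit

/-! ### Face models and the edge components of L -/

/-- The map `σ` replaces the middle vertex of a path `l → l y → (l y) x` by the fourth corner of a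
face, and any three corners of a face determine the remaining one. -/
structure IsFaceModel {Q : Type*} [Mul Q] (σ : Q → Q × Q → Q × Q) (F : Q → Q → Q → Q → Prop) :
    Prop where
  sigma_iff : ∀ l x y a c,
    σ l (x, y) = (a, c) ↔ F l (l * y) ((l * y) * x) (l * c) ∧ (l * c) * a = (l * y) * x
  existsUnique₁ : ∀ b c d, ∃! a, F a b c d
  existsUnique₂ : ∀ a c d, ∃! b, F a b c d
  existsUnique₃ : ∀ a b d, ∃! c, F a b c d
  existsUnique₄ : ∀ a b c, ∃! d, F a b c d

section Faces

variable (K : Type*) [Field K] {Q : Type*} [Mul Q] [IsQuasigroup Q] [Fintype Q]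
  {σ : Q → Q × Q → Q × Q} {F : Q → Q → Q → Q → Prop}

/-- If u and v have the same quotient q into w, then uq = w = vq and right cancellation gives u = v;
finiteness does the rest. It allows sums over an index c to be rewritten as sums over the source of
an edge ending at w. -/
lemma ldiv_left_bijective (w : Q) : Function.Bijective fun u => ldiv u w := by
  refine Finite.injective_iff_bijective.1 fun u v h => ?_
  have h₁ := mul_ldiv u w
  have h₂ := mul_ldiv v w
  change ldiv u w = ldiv v w at h
  rw [h] at h₁
  exact (mul_right_bijective' (ldiv v w)).1 (h₁.trans h₂.symm)

variable (σ) in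
/-- The idempotent `e_a ⊗ e_a'`. -/
def pp (a a' : Q) : FRTAlg K σ := src K σ (delta K a) * tgt K σ (delta K a')

lemma pp_mul_src (a a' : Q) (f : Q → K) : pp K σ a a' * src K σ f = f a • pp K σ a a' := by
  rw [pp, mul_assoc, ← src_tgt_comm, ← mul_assoc, ← map_mul, delta_mul, map_smul, smul_mul_assoc]

lemma pp_mul_tgt (a a' : Q) (f : Q → K) : pp K σ a a' * tgt K σ f = f a' • pp K σ a a' := by
  rw [pp, mul_assoc, ← map_mul, delta_mul, map_smul, mul_smul_comm]

lemma src_mul_pp (a a' : Q) (f : Q → K) : src K σ f * pp K σ a a' = f a • pp K σ a a' := by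
  rw [pp, ← mul_assoc, ← map_mul, mul_delta, map_smul, smul_mul_assoc]

lemma tgt_mul_pp (a a' : Q) (f : Q → K) : tgt K σ f * pp K σ a a' = f a' • pp K σ a a' := by
  rw [pp, ← mul_assoc, ← src_tgt_comm, mul_assoc, ← map_mul, mul_delta, map_smul, mul_smul_comm]

lemma pp_mul_pp (a a' b b' : Q) :
    pp K σ a a' * pp K σ b b' = delta K b a • delta K b' a' • pp K σ a a' := by
  conv_lhs => rw [pp.eq_def K σ b b', ← mul_assoc, pp_mul_src, smul_mul_assoc, pp_mul_tgt]

lemma delta_self (a : Q) : delta K a a = 1 := by simp [delta]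

lemma pp_mul_self (a a' : Q) : pp K σ a a' * pp K σ a a' = pp K σ a a' := by
  rw [pp_mul_pp, delta_self, delta_self, one_smul, one_smul]

lemma sum_pp : ∑ a, ∑ a', pp K σ a a' = 1 := by
  simp_rw [pp, ← Finset.mul_sum, ← Finset.sum_mul, ← map_sum, sum_delta, map_one, mul_one]

lemma eq_of_pp_mul_eq {x y : FRTAlg K σ} (h : ∀ a a', pp K σ a a' * x = pp K σ a a' * y) :
    x = y := by
  rw [← one_mul x, ← one_mul y, ← sum_pp]
  simp_rw [Finset.sum_mul, h]

lemma eq_of_mul_pp_eq {x y : FRTAlg K σ} (h : ∀ a a', x * pp K σ a a' = y * pp K σ a a') :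
    x = y := by
  rw [← mul_one x, ← mul_one y, ← sum_pp]
  simp_rw [Finset.mul_sum, h]

lemma pp_mul_genL (a a' u v : Q) :
    pp K σ a a' * genL K σ u v = genL K σ u v * pp K σ (a * u) (a' * v) := by
  rw [pp, pp, mul_assoc, ← shift_delta K a' v, tgt_mul_genL, ← mul_assoc, ← shift_delta K a u,
    src_mul_genL, mul_assoc]

lemma pp_mul_genLinv (a a' u v : Q) :
    pp K σ (a * u) (a' * v) * genLinv K σ v u = genLinv K σ v u * pp K σ a a' := by
  rw [pp, pp, mul_assoc, tgt_mul_genLinv, ← mul_assoc, src_mul_genLinv, mul_assoc, shift_delta,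
    shift_delta]

variable (σ) in
/-- The component of `L` between the edges `a → b` and `a' → b'`. -/
def edgeL (a b a' b' : Q) : FRTAlg K σ := pp K σ a a' * genL K σ (ldiv a b) (ldiv a' b')

variable (σ) in
/-- The component of `L⁻¹` between the edges `a → b` and `a' → b'`. -/
def edgeLinv (a b a' b' : Q) : FRTAlg K σ := genLinv K σ (ldiv a' b') (ldiv a b) * pp K σ a a'

lemma edgeL_eq (a b a' b' : Q) :
    edgeL K σ a b a' b' = genL K σ (ldiv a b) (ldiv a' b') * pp K σ b b' := by
  rw [edgeL, pp_mul_genL, mul_ldiv, mul_ldiv]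

lemma edgeLinv_eq (a b a' b' : Q) :
    edgeLinv K σ a b a' b' = pp K σ b b' * genLinv K σ (ldiv a' b') (ldiv a b) := by
  rw [edgeLinv, ← pp_mul_genLinv, mul_ldiv, mul_ldiv]

lemma pp_mul_edgeL (a b a' b' : Q) : pp K σ a a' * edgeL K σ a b a' b' = edgeL K σ a b a' b' := by
  rw [edgeL, ← mul_assoc, pp_mul_self]

lemma edgeL_mul_pp (a b a' b' : Q) : edgeL K σ a b a' b' * pp K σ b b' = edgeL K σ a b a' b' := by
  rw [edgeL_eq, mul_assoc, pp_mul_self]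

lemma pp_mul_edgeLinv (a b a' b' : Q) :
    pp K σ b b' * edgeLinv K σ a b a' b' = edgeLinv K σ a b a' b' := by
  rw [edgeLinv_eq, ← mul_assoc, pp_mul_self]

lemma edgeLinv_mul_pp (a b a' b' : Q) :
    edgeLinv K σ a b a' b' * pp K σ a a' = edgeLinv K σ a b a' b' := by
  rw [edgeLinv, mul_assoc, pp_mul_self]

/-- The relation LL⁻¹ = 1 in edge form: the sum runs over targets of edges starting at a'. The
companion L⁻¹L = 1 becomes a sum over sources in the unprimed copy. The sums over the other two
kinds of endpoint do not follow from these relations alone and need faces. -/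
lemma sum_edgeL_mul_edgeLinv (a b a' d : Q) :
    ∑ b', edgeL K σ a b a' b' * edgeLinv K σ d b a' b' = delta K a d • pp K σ a a' := by
  rw [← Fintype.sum_bijective _ (mul_left_bijective' a') _ _ fun _ => rfl]
  simp_rw [edgeL, edgeLinv, ldiv_mul, mul_assoc, ← Finset.mul_sum, ← mul_assoc (genL K σ _ _),
    ← Finset.sum_mul, sum_genL_genLinv]
  by_cases h : a = d
  · subst h
    rw [delta_self, delta_self, one_smul, one_mul, pp_mul_self, one_smul]
  · rw [smul_mul_assoc, one_mul, mul_smul_comm, pp_mul_pp]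
    simp [delta, h, Ne.symm h]

lemma sum_edgeLinv_mul_edgeL (b a' b' d' : Q) :
    ∑ a, edgeLinv K σ a b a' b' * edgeL K σ a b a' d' = delta K b' d' • pp K σ b b' := by
  simp_rw [edgeL_eq, edgeLinv_eq, mul_assoc, ← Finset.mul_sum, ← mul_assoc (genLinv K σ _ _),
    ← Finset.sum_mul]
  rw [Fintype.sum_bijective _ (ldiv_left_bijective b) _
    (fun c => genLinv K σ (ldiv a' b') c * genL K σ c (ldiv a' d')) fun _ => rfl,
    sum_genLinv_genL]
  by_cases h : b' = d'
  · subst h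
    rw [delta_self, delta_self, one_smul, one_mul, pp_mul_self, one_smul]
  · rw [smul_mul_assoc, one_mul, mul_smul_comm, pp_mul_pp]
    simp [delta, h, Ne.symm h]

lemma IsFaceModel.weight (hF : IsFaceModel σ F) (l x y a c : Q) (h : σ l (x, y) = (a, c)) :
    (l * c) * a = (l * y) * x :=
  ((hF.sigma_iff l x y a c).1 h).2

/-- The corners a, g, c determine b, so exactly one path is sent by σ(a) to the path through g. The
corresponding sum in the exchange relation has a single surviving term. -/
lemma sigmaCoeff_target (hF : IsFaceModel σ F) {a b c g : Q} (h : F a b c g) (x y : Q) :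
    sigmaCoeff K σ x y (ldiv g c) (ldiv a g) a = delta K (ldiv b c) x * delta K (ldiv a b) y := by
  have e : σ a (x, y) = (ldiv g c, ldiv a g) ↔ ldiv a b = y ∧ ldiv b c = x := by
    rw [hF.sigma_iff, mul_ldiv, mul_ldiv, eq_comm (b := y), eq_comm (b := x), eq_ldiv_iff,
      eq_ldiv_iff]
    constructor
    · rintro ⟨h₁, h₂⟩
      rw [← h₂] at h₁
      have e := (hF.existsUnique₂ a c g).unique h₁ h
      exact ⟨e, e ▸ h₂.symm⟩
    · rintro ⟨rfl, rfl⟩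
      exact ⟨h, rfl⟩
  by_cases h₁ : ldiv a b = y <;> by_cases h₂ : ldiv b c = x <;> simp [sigmaCoeff, delta, e, h₁, h₂]

lemma sigmaCoeff_source (hF : IsFaceModel σ F) {a b c g : Q} (h : F a b c g) (x y : Q) :
    sigmaCoeff K σ (ldiv b c) (ldiv a b) x y a = delta K (ldiv g c) x * delta K (ldiv a g) y := by
  have e : σ a (ldiv b c, ldiv a b) = (x, y) ↔ ldiv a g = y ∧ ldiv g c = x := by
    rw [hF.sigma_iff, mul_ldiv, mul_ldiv, eq_comm (b := y), eq_comm (b := x), eq_ldiv_iff,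
      eq_ldiv_iff]
    constructor
    · rintro ⟨h₁, h₂⟩
      have e := (hF.existsUnique₄ a b c).unique h₁ h
      exact ⟨e, e ▸ h₂⟩
    · rintro ⟨rfl, h₂⟩
      exact ⟨h, h₂⟩
  by_cases h₁ : ldiv a g = y <;> by_cases h₂ : ldiv g c = x <;> simp [sigmaCoeff, delta, e, h₁, h₂]

lemma edgeL_mul_edgeL (a b c a' b' c' : Q) :
    edgeL K σ a b a' b' * edgeL K σ b c b' c' =
      pp K σ a a' * (genL K σ (ldiv a b) (ldiv a' b') * genL K σ (ldiv b c) (ldiv b' c')) := by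
  conv_lhs => rw [edgeL_eq, edgeL, mul_assoc, ← mul_assoc (pp K σ b b'), pp_mul_self, ← mul_assoc,
    ← edgeL_eq, edgeL, mul_assoc]

/-- Cutting the exchange relation by e_a ⊗ e_{a'} evaluates its coefficients at a and a', and each
double sum then collapses to one term. The result says that the product of edge components along a →
b → c agrees with that along a → g → c. -/
lemma edgeL_face (hF : IsFaceModel σ F) {a b c g a' b' c' g' : Q} (h : F a b c g)
    (h' : F a' b' c' g') :
    edgeL K σ a b a' b' * edgeL K σ b c b' c' = edgeL K σ a g a' g' * edgeL K σ g c g' c' := by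
  have e := congrArg (pp K σ a a' * ·) (rll K σ (ldiv g c) (ldiv b' c') (ldiv a g) (ldiv a' b'))
  simp_rw [Finset.mul_sum, mul_assoc, ← mul_assoc (pp K σ a a'), pp_mul_src, pp_mul_tgt,
    sigmaCoeff_target K hF h, sigmaCoeff_source K hF h', smul_mul_assoc, mul_smul,
    ← Finset.smul_sum, sum_delta_smul] at e
  rw [edgeL_mul_edgeL K, edgeL_mul_edgeL K, e]

/-- Formally this is `edgeL_face` with one L moved to each side. As the components are not
individually invertible, a double sum over x and c'' is used that contains L⁻¹L on the left and LL⁻¹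
on the right. Collapsing the left part gives one side; applying `edgeL_face` in the middle and then
collapsing the right part gives the other. -/
lemma edgeL_mul_edgeLinv (hF : IsFaceModel σ F) {a b c g a' b' c' g' : Q} (h : F a b c g)
    (h' : F a' b' c' g') :
    edgeL K σ b c b' c' * edgeLinv K σ g c g' c' =
      edgeLinv K σ a b a' b' * edgeL K σ a g a' g' := by
  choose f₂ hf₂ _ using fun c'' => hF.existsUnique₂ a' c'' g'
  choose f₄ hf₄ _ using fun x => hF.existsUnique₄ x b c
  have e₁ : ∑ c'', (∑ x, edgeLinv K σ x b a' b' * edgeL K σ x b a' (f₂ c'')) *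
      (edgeL K σ b c (f₂ c'') c'' * edgeLinv K σ g c g' c'') =
      edgeL K σ b c b' c' * edgeLinv K σ g c g' c' := by
    have hc : f₂ c' = b' := (hF.existsUnique₂ a' c' g').unique (hf₂ c') h'
    simp_rw [sum_edgeLinv_mul_edgeL]
    rw [Finset.sum_eq_single c']
    · rw [hc, delta_self, one_smul, ← mul_assoc, pp_mul_edgeL]
    · intro c'' _ hne
      -- The collapsed sum selects f₂ c'' = b', and the third corner is determined by the others, so
      -- only c'' = c' survives.
      have : b' ≠ f₂ c'' := fun e =>
        hne ((hF.existsUnique₃ a' b' g').unique (e ▸ hf₂ c'') h')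
      simp [delta, this]
    · simp
  have e₂ : ∑ x, (edgeLinv K σ x b a' b' * edgeL K σ x (f₄ x) a' g') *
      (∑ c'', edgeL K σ (f₄ x) c g' c'' * edgeLinv K σ g c g' c'') =
      edgeLinv K σ a b a' b' * edgeL K σ a g a' g' := by
    have hg : f₄ a = g := (hF.existsUnique₄ a b c).unique (hf₄ a) h
    simp_rw [sum_edgeL_mul_edgeLinv]
    rw [Finset.sum_eq_single a]
    · rw [hg, delta_self, one_smul, mul_assoc, edgeL_mul_pp]
    · intro x _ hne
      -- Here the selection f₄ x = g fixes the first corner, so only x = a survives.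
      have : f₄ x ≠ g := fun e =>
        hne ((hF.existsUnique₁ b c g).unique (e ▸ hf₄ x) h)
      simp [delta, this]
    · simp
  rw [← e₁, ← e₂]
  simp_rw [Finset.sum_mul, Finset.mul_sum]
  rw [Finset.sum_comm]
  refine Finset.sum_congr rfl fun x _ => Finset.sum_congr rfl fun c'' _ => ?_
  rw [mul_assoc, ← mul_assoc (edgeL K σ x b a' (f₂ c'')), edgeL_face K hF (hf₄ x) (hf₂ c'')]
  simp only [mul_assoc]

/-- The same insertion once more, now with the mixed relation `edgeL_mul_edgeLinv` applied in the
middle, turns the remaining L's into inverses. This is the exchange relation for L⁻¹ in edge form.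
-/
lemma edgeLinv_face (hF : IsFaceModel σ F) {a b c g a' b' c' g' : Q} (h : F a b c g)
    (h' : F a' b' c' g') :
    edgeLinv K σ b c b' c' * edgeLinv K σ a b a' b' =
      edgeLinv K σ g c g' c' * edgeLinv K σ a g a' g' := by
  choose f₃ hf₃ _ using fun g'' => hF.existsUnique₃ a' b' g''
  choose f₁ hf₁ _ using fun x => hF.existsUnique₁ x c g
  have e₁ : ∑ g'', (∑ x, edgeLinv K σ x c b' c' * edgeL K σ x c b' (f₃ g'')) *
      (edgeLinv K σ g c g'' (f₃ g'') * edgeLinv K σ a g a' g'') =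
      edgeLinv K σ g c g' c' * edgeLinv K σ a g a' g' := by
    have hc : f₃ g' = c' := (hF.existsUnique₃ a' b' g').unique (hf₃ g') h'
    simp_rw [sum_edgeLinv_mul_edgeL]
    rw [Finset.sum_eq_single g']
    · rw [hc, delta_self, one_smul, ← mul_assoc, pp_mul_edgeLinv]
    · intro g'' _ hne
      have : c' ≠ f₃ g'' := fun e =>
        hne ((hF.existsUnique₄ a' b' c').unique (e ▸ hf₃ g'') h')
      simp [delta, this]
    · simp
  have e₂ : ∑ x, (edgeLinv K σ x c b' c' * edgeLinv K σ (f₁ x) x a' b') *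
      (∑ g'', edgeL K σ (f₁ x) g a' g'' * edgeLinv K σ a g a' g'') =
      edgeLinv K σ b c b' c' * edgeLinv K σ a b a' b' := by
    have hg : f₁ b = a := (hF.existsUnique₁ b c g).unique (hf₁ b) h
    simp_rw [sum_edgeL_mul_edgeLinv]
    rw [Finset.sum_eq_single b]
    · rw [hg, delta_self, one_smul, mul_assoc, edgeLinv_mul_pp]
    · intro x _ hne
      have : f₁ x ≠ a := fun e =>
        hne ((hF.existsUnique₂ a c g).unique (e ▸ hf₁ x) h)
      simp [delta, this]
    · simp
  rw [← e₁, ← e₂]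
  simp_rw [Finset.sum_mul, Finset.mul_sum]
  rw [Finset.sum_comm]
  refine Finset.sum_congr rfl fun g'' _ => Finset.sum_congr rfl fun x _ => ?_
  have e := edgeL_mul_edgeLinv K hF (hf₁ x) (hf₃ g'')
  rw [mul_assoc, ← mul_assoc (edgeLinv K σ (f₁ x) x a' b'), ← e]
  simp only [mul_assoc]

/-- Faces whose second and fourth corners are both b convert each term into L⁻¹L by
`edgeL_mul_edgeLinv`. As c varies, the first corner of the face runs once through Q, so the sum
becomes the known one over sources. -/
lemma sum_edgeL_mul_edgeLinv_source (hF : IsFaceModel σ F) (b b' c' g' : Q) :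
    ∑ c, edgeL K σ b c b' c' * edgeLinv K σ b c g' c' = delta K b' g' • pp K σ b b' := by
  obtain ⟨a', h', -⟩ := hF.existsUnique₁ b' c' g'
  choose f₁ hf₁ _ using fun c => hF.existsUnique₁ b c b
  have hbij : Function.Bijective f₁ := Finite.injective_iff_bijective.1 fun c d h =>
    (hF.existsUnique₃ (f₁ c) b b).unique (hf₁ c) (h ▸ hf₁ d)
  rw [← sum_edgeLinv_mul_edgeL K b a' b' g']
  exact Fintype.sum_bijective f₁ hbij _ _ fun c => edgeL_mul_edgeLinv K hF (hf₁ c) h'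

/-- Here the degenerate faces, with second and fourth corners equal, lie in the primed copy, and
`edgeL_mul_edgeLinv` is read from right to left. -/
lemma sum_edgeLinv_mul_edgeL_target (hF : IsFaceModel σ F) (a b g b' : Q) :
    ∑ a', edgeLinv K σ a b a' b' * edgeL K σ a g a' b' = delta K b g • pp K σ b b' := by
  obtain ⟨c, h, -⟩ := hF.existsUnique₃ a b g
  choose f₃ hf₃ _ using fun a' => hF.existsUnique₃ a' b' b'
  have hbij : Function.Bijective f₃ := Finite.injective_iff_bijective.1 fun c d h =>
    (hF.existsUnique₁ b' (f₃ c) b').unique (hf₃ c) (h ▸ hf₃ d)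
  rw [← sum_edgeL_mul_edgeLinv K b c b' g]
  exact Fintype.sum_bijective f₃ hbij _ _ fun a' => (edgeL_mul_edgeLinv K hF h (hf₃ a')).symm

/-- One of the two inverse relations needed in the opposite algebra. It is not among the defining
relations and comes from `sum_edgeL_mul_edgeLinv_source` on each component. -/
lemma sum_genL_genLinv_op (hF : IsFaceModel σ F) (a b : Q) :
    ∑ c, genL K σ c b * genLinv K σ a c = delta K a b • (1 : FRTAlg K σ) := by
  refine eq_of_pp_mul_eq K fun l m => ?_
  -- With na = mb, the generator (L⁻¹)_{ac} becomes a component on the edges l → lc and n → mb,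
  -- meeting the target of m → mb. Cancellation then identifies δ_{ab} with δ_{mn}.
  obtain ⟨n, hn⟩ := (mul_right_bijective' a).2 (m * b)
  change n * a = m * b at hn
  have h := sum_edgeL_mul_edgeLinv_source K hF l m (m * b) n
  rw [← Fintype.sum_bijective _ (mul_left_bijective' l) _ _ fun _ => rfl] at h
  rw [Finset.mul_sum, mul_smul_comm, mul_one]
  have hd : delta K a b = delta K m n := by
    by_cases e : m = n
    · subst e
      rw [(mul_left_bijective' m).1 hn, delta_self, delta_self]
    · have : a ≠ b := fun e' => e ((mul_right_bijective' b).1 (e' ▸ hn).symm)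
      simp [delta, e, this]
  rw [hd, ← h]
  refine Finset.sum_congr rfl fun c _ => ?_
  have e₁ : edgeL K σ l (l * c) m (m * b) = pp K σ l m * genL K σ c b := by
    rw [edgeL, ldiv_mul, ldiv_mul]
  have e₂ : edgeLinv K σ l (l * c) n (m * b) = pp K σ (l * c) (m * b) * genLinv K σ a c := by
    rw [edgeLinv_eq, ldiv_mul, ← hn, ldiv_mul]
  rw [e₂, ← mul_assoc (edgeL K σ _ _ _ _), edgeL_mul_pp, e₁, mul_assoc]

lemma sum_genLinv_genL_op (hF : IsFaceModel σ F) (a b : Q) :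
    ∑ c, genLinv K σ c b * genL K σ a c = delta K a b • (1 : FRTAlg K σ) := by
  refine eq_of_pp_mul_eq K fun l m => ?_
  obtain ⟨n, rfl⟩ := (mul_right_bijective' b).2 l
  have h := sum_edgeLinv_mul_edgeL_target K hF n (n * b) (n * a) m
  have hd : delta K a b = delta K (n * b) (n * a) := by
    by_cases e : a = b
    · rw [e, delta_self, delta_self]
    · have : n * b ≠ n * a := fun e' => e ((mul_left_bijective' n).1 e').symm
      simp [delta, e, this]
  rw [Finset.mul_sum, mul_smul_comm, mul_one, hd]
  refine Eq.trans ?_ h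
  -- The summation index of the generators is c = p \ m for the source p of an edge ending at m.
  refine (Fintype.sum_bijective _ (ldiv_left_bijective m) _ _ fun p => ?_).symm
  rw [edgeL, ← mul_assoc, edgeLinv_mul_pp, edgeLinv_eq, ldiv_mul, ldiv_mul, mul_assoc]

lemma edgeLinv_mul_edgeLinv (a b c a' b' c' : Q) :
    edgeLinv K σ b c b' c' * edgeLinv K σ a b a' b' =
      genLinv K σ (ldiv b' c') (ldiv b c) * genLinv K σ (ldiv a' b') (ldiv a b) * pp K σ a a' := by
  conv_lhs => rw [edgeLinv_eq K a, edgeLinv, mul_assoc, ← mul_assoc (pp K σ b b'), pp_mul_self,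
    ← edgeLinv_eq, edgeLinv, ← mul_assoc]

/-- Multiplication by e_l ⊗ e_m on the right evaluates the coefficients, at m on the t-side and at l
on the s-side. What remains is `edgeLinv_face` for the face completed at its fourth corner from l
and the one completed at its second corner from m. -/
lemma rll_op (hF : IsFaceModel σ F) (a b c d : Q) :
    ∑ x, ∑ y, genLinv K σ x b * (genLinv K σ y d * tgt K σ (sigmaCoeff K σ x y a c)) =
      ∑ x, ∑ y, genLinv K σ a x * (genLinv K σ c y * src K σ (sigmaCoeff K σ b d x y)) := by
  refine eq_of_mul_pp_eq K fun l m => ?_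
  obtain ⟨g, hg, -⟩ := hF.existsUnique₄ l (l * d) ((l * d) * b)
  obtain ⟨b', hb', -⟩ := hF.existsUnique₂ m ((m * c) * a) (m * c)
  have e₁ := sigmaCoeff_target K hF hb'
  have e₂ := sigmaCoeff_source K hF hg
  rw [ldiv_mul, ldiv_mul] at e₁ e₂
  have e := edgeLinv_face K hF hg hb'
  rw [edgeLinv_mul_edgeLinv K, edgeLinv_mul_edgeLinv K, ldiv_mul, ldiv_mul, ldiv_mul,
    ldiv_mul] at e
  simp_rw [Finset.sum_mul, mul_assoc, tgt_mul_pp, src_mul_pp, e₁, e₂, mul_smul_comm, mul_smul,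
    ← Finset.smul_sum, sum_delta_smul]
  simpa only [mul_assoc] using e

end Faces

/-! ### The antipode and its axioms -/

section Antipode

open scoped Classical

variable (K : Type*) [Field K] {Q : Type*} [Mul Q] [IsQuasigroup Q] [Fintype Q]
  {σ : Q → Q × Q → Q × Q} {F : Q → Q → Q → Q → Prop} (hF : IsFaceModel σ F)

lemma shift_surjective (a : Q) : Function.Surjective (shift (K := K) a) := fun f =>
  ⟨(shiftMat K a).transpose.mulVec f, by
    rw [← shiftMat_mulVec, Matrix.mulVec_mulVec, shiftMat_mul_transpose, Matrix.one_mulVec]⟩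

/-- An algebra map from a commutative algebra, as a map to the opposite algebra. -/
def toOpHom {C A : Type*} [CommRing C] [Algebra K C] [Ring A] [Algebra K A] (f : C →ₐ[K] A) :
    C →ₐ[K] Aᵐᵒᵖ :=
  f.toOpposite fun x y => (Commute.all x y).map f

/-- The antipode as an algebra map to the opposite algebra. -/
def antipodeImage : FRTImage K σ (FRTAlg K σ)ᵐᵒᵖ where
  u := toOpHom K (tgt K σ)
  v := toOpHom K (src K σ)
  comm f g := MulOpposite.unop_injective (src_tgt_comm K σ g f)
  ℓ a b := MulOpposite.op (genLinv K σ a b)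
  ℓ' a b := MulOpposite.op (genL K σ a b)
  sum_ℓ_ℓ' a b := MulOpposite.unop_injective (by
    simpa [Finset.unop_sum] using sum_genL_genLinv_op K hF a b)
  sum_ℓ'_ℓ a b := MulOpposite.unop_injective (by
    simpa [Finset.unop_sum] using sum_genLinv_genL_op K hF a b)
  u_ℓ f a b := MulOpposite.unop_injective (tgt_mul_genLinv K σ f a b).symm
  v_ℓ f a b := MulOpposite.unop_injective (src_mul_genLinv K σ f a b).symm
  u_ℓ' f a b := MulOpposite.unop_injective (tgt_mul_genL K σ f a b).symm
  v_ℓ' f a b := MulOpposite.unop_injective (src_mul_genL K σ f a b).symm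
  rll a b c d := MulOpposite.unop_injective (by
    simpa [Finset.unop_sum, toOpHom] using rll_op K hF a b c d)

/-- The antipode. -/
def antipode : FRTAlg K σ →ₗ[K] FRTAlg K σ :=
  (MulOpposite.opLinearEquiv K).symm.toLinearMap ∘ₗ (antipodeImage K hF).lift.toLinearMap

lemma antipode_mul (a b : FRTAlg K σ) :
    antipode K hF (a * b) = antipode K hF b * antipode K hF a := by
  simp [antipode]

lemma antipode_src (f : Q → K) : antipode K hF (src K σ f) = tgt K σ f := by
  simp [antipode, antipodeImage, toOpHom]

lemma antipode_tgt (f : Q → K) : antipode K hF (tgt K σ f) = src K σ f := by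
  simp [antipode, antipodeImage, toOpHom]

lemma antipode_genL (a b : Q) : antipode K hF (genL K σ a b) = genLinv K σ a b := by
  simp [antipode, antipodeImage]

lemma antipode_genLinv (a b : Q) : antipode K hF (genLinv K σ a b) = genL K σ a b := by
  simp [antipode, antipodeImage]

lemma antipode_one : antipode K hF 1 = 1 := by
  simp [antipode]

lemma antipode_antipode (a : FRTAlg K σ) : antipode K hF (antipode K hF a) = a := by
  induction a using frt_induction with
  | hs f => rw [antipode_src, antipode_tgt]
  | ht f => rw [antipode_tgt, antipode_src]
  | hL a b => rw [antipode_genL, antipode_genLinv]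
  | hL' a b => rw [antipode_genLinv, antipode_genL]
  | hadd a b ha hb => rw [map_add, map_add, ha, hb]
  | hmul a b ha hb => rw [antipode_mul, antipode_mul, ha, hb]

/-- `x ⊗ y ↦ S(x) y` -/
def contractS : FRTAlg K σ ⊗[K] FRTAlg K σ →ₗ[K] FRTAlg K σ :=
  LinearMap.mul' K _ ∘ₗ TensorProduct.map (antipode K hF) LinearMap.id

lemma contractS_tmul (x y : FRTAlg K σ) : contractS K hF (x ⊗ₜ y) = antipode K hF x * y := rfl

lemma contractS_sepIdem_mul (z : FRTAlg K σ ⊗[K] FRTAlg K σ) :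
    contractS K hF (sepIdem K σ * z) = contractS K hF z := by
  refine tensor_congr K (F := contractS K hF ∘ₗ LinearMap.mulLeft K (sepIdem K σ))
    (G := contractS K hF) (fun x y => ?_) z
  simp only [LinearMap.comp_apply, LinearMap.mulLeft_apply, sepIdem, Finset.sum_mul,
    Algebra.TensorProduct.tmul_mul_tmul, map_sum, contractS_tmul, antipode_mul, antipode_tgt]
  simp_rw [mul_assoc, ← mul_assoc (src K σ _), ← map_mul, delta_mul_self]
  rw [← Finset.mul_sum, ← Finset.sum_mul, ← map_sum, sum_delta, map_one, one_mul]

lemma contractS_mul_tmul (z : FRTAlg K σ ⊗[K] FRTAlg K σ) (x y : FRTAlg K σ) :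
    contractS K hF (z * (x ⊗ₜ y)) = antipode K hF x * contractS K hF z * y := by
  refine tensor_congr K (F := contractS K hF ∘ₗ LinearMap.mulRight K (x ⊗ₜ y))
    (G := LinearMap.mulRight K y ∘ₗ LinearMap.mulLeft K (antipode K hF x) ∘ₗ contractS K hF)
    (fun a b => ?_) z
  simp [contractS_tmul, antipode_mul, mul_assoc]

/-- In S(a)·(contraction of z)·b, the middle factor t(f) can be regarded as part of the second leg
of a ⊗ b. -/
lemma contractS_mul_of_eq_tgt (z w : FRTAlg K σ ⊗[K] FRTAlg K σ) (f : Q → K)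
    (hz : contractS K hF z = tgt K σ f) :
    contractS K hF (z * w) = contractS K hF ((1 ⊗ₜ tgt K σ f) * w) := by
  refine tensor_congr K (F := contractS K hF ∘ₗ LinearMap.mulLeft K z)
    (G := contractS K hF ∘ₗ LinearMap.mulLeft K (1 ⊗ₜ tgt K σ f)) (fun a b => ?_) w
  simp [contractS_mul_tmul, hz, contractS_tmul, mul_assoc]

/-- The map a ↦ S(a₍₁₎)a₍₂₎ is not multiplicative, so the antipode axiom by itself does not pass to
products. Carrying an arbitrary f makes the statement one about the right action of A on functions,
which composes along products; f = 1 is the axiom. -/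
lemma contractS_tgt_mul_comul (a : FRTAlg K σ) (f : Q → K) :
    contractS K hF ((1 ⊗ₜ tgt K σ f) * comul K σ a) =
      tgt K σ (Matrix.vecMul f (matRep K hF.weight a)) := by
  induction a using frt_induction generalizing f with
  | hs g =>
    rw [comul_src, ← mul_assoc, ← (sepIdem_comm_tgt K σ f).eq, mul_assoc, contractS_sepIdem_mul,
      matRep_src, vecMul_diagonal_eq, mul_comm f, map_mul (tgt K σ)]
    simp [contractS_tmul, antipode_src]
  | ht g =>
    rw [comul_tgt, ← mul_assoc, ← (sepIdem_comm_tgt K σ f).eq, mul_assoc, contractS_sepIdem_mul,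
      matRep_tgt, vecMul_diagonal_eq, map_mul (tgt K σ)]
    simp [contractS_tmul, antipode_one]
  | hL a b =>
    -- Only shifted functions pass L_{cb} from left to right; since T_b is surjective, f can be
    -- taken of that form.
    obtain ⟨g, rfl⟩ := shift_surjective K b f
    rw [comul_genL, ← mul_assoc, ← (sepIdem_comm_tgt K σ _).eq, mul_assoc, contractS_sepIdem_mul]
    simp only [comulL, Finset.mul_sum, Algebra.TensorProduct.tmul_mul_tmul, one_mul, map_sum,
      contractS_tmul, antipode_genL, tgt_mul_genL]
    simp_rw [← mul_assoc]
    rw [← Finset.sum_mul, sum_genLinv_genL, matRep_genL, Matrix.vecMul_smul, map_smul,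
      smul_mul_assoc, one_mul]
    by_cases h : a = b
    · subst h
      rw [← Matrix.mulVec_transpose, transpose_mulVec_shift]
    · simp [delta, h]
  | hL' a b =>
    rw [comul_genLinv, ← mul_assoc, ← (sepIdem_comm_tgt K σ _).eq, mul_assoc,
      contractS_sepIdem_mul]
    simp only [comulLinv, Finset.mul_sum, Algebra.TensorProduct.tmul_mul_tmul, one_mul, map_sum,
      contractS_tmul, antipode_genLinv, tgt_mul_genLinv]
    simp_rw [← mul_assoc]
    rw [← Finset.sum_mul, sum_genL_genLinv_op K hF, matRep_genLinv, Matrix.vecMul_smul, map_smul,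
      smul_mul_assoc, one_mul, Matrix.vecMul_transpose, shiftMat_mulVec]
  | hadd a b ha hb =>
    rw [map_add, mul_add, map_add, ha, hb, map_add, Matrix.vecMul_add, map_add]
  | hmul a b ha hb =>
    rw [comul_mul, ← mul_assoc, contractS_mul_of_eq_tgt K hF _ _ _ (ha f), hb, map_mul,
      Matrix.vecMul_vecMul]

/-- `x ⊗ y ↦ x S(y)` -/
def contractS' : FRTAlg K σ ⊗[K] FRTAlg K σ →ₗ[K] FRTAlg K σ :=
  LinearMap.mul' K _ ∘ₗ TensorProduct.map LinearMap.id (antipode K hF)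

lemma contractS'_tmul (x y : FRTAlg K σ) : contractS' K hF (x ⊗ₜ y) = x * antipode K hF y := rfl

lemma contractS'_mul_sepIdem (z : FRTAlg K σ ⊗[K] FRTAlg K σ) :
    contractS' K hF (z * sepIdem K σ) = contractS' K hF z := by
  refine tensor_congr K (F := contractS' K hF ∘ₗ LinearMap.mulRight K (sepIdem K σ))
    (G := contractS' K hF) (fun x y => ?_) z
  simp only [LinearMap.comp_apply, LinearMap.mulRight_apply, sepIdem, Finset.mul_sum,
    Algebra.TensorProduct.tmul_mul_tmul, map_sum, contractS'_tmul, antipode_mul, antipode_src]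
  simp_rw [mul_assoc, ← mul_assoc (tgt K σ _), ← map_mul, delta_mul_self]
  rw [← Finset.mul_sum, ← Finset.sum_mul, ← map_sum, sum_delta, map_one, one_mul]

lemma contractS'_tmul_mul (z : FRTAlg K σ ⊗[K] FRTAlg K σ) (x y : FRTAlg K σ) :
    contractS' K hF ((x ⊗ₜ y) * z) = x * contractS' K hF z * antipode K hF y := by
  refine tensor_congr K (F := contractS' K hF ∘ₗ LinearMap.mulLeft K (x ⊗ₜ y))
    (G := LinearMap.mulRight K (antipode K hF y) ∘ₗ LinearMap.mulLeft K x ∘ₗ contractS' K hF)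
    (fun a b => ?_) z
  simp [contractS'_tmul, antipode_mul, mul_assoc]

lemma contractS'_mul_of_eq_src (z w : FRTAlg K σ ⊗[K] FRTAlg K σ) (f : Q → K)
    (hw : contractS' K hF w = src K σ f) :
    contractS' K hF (z * w) = contractS' K hF (z * (src K σ f ⊗ₜ 1)) := by
  refine tensor_congr K (F := contractS' K hF ∘ₗ LinearMap.mulRight K w)
    (G := contractS' K hF ∘ₗ LinearMap.mulRight K (src K σ f ⊗ₜ 1)) (fun a b => ?_) z
  simp [contractS'_tmul_mul, hw, contractS'_tmul, mul_assoc]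

/-- The mirror statement uses the left action on functions: in a product, the right factor acts
first on f. Taking f = 1 gives the second antipode axiom. -/
lemma contractS'_comul_mul_src (a : FRTAlg K σ) (f : Q → K) :
    contractS' K hF (comul K σ a * (src K σ f ⊗ₜ 1)) =
      src K σ ((matRep K hF.weight a).mulVec f) := by
  induction a using frt_induction generalizing f with
  | hs g =>
    rw [comul_src, mul_assoc, (sepIdem_comm_src K σ _).mul_right (sepIdem_comm_src K σ _) |>.eq,
      contractS'_mul_sepIdem, matRep_src, diagonal_mulVec_eq,
      map_mul (src K σ)]
    simp [contractS'_tmul, antipode_one]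
  | ht g =>
    rw [comul_tgt, mul_assoc, (sepIdem_comm_tgt K σ _).mul_right (sepIdem_comm_src K σ _) |>.eq,
      contractS'_mul_sepIdem, matRep_tgt, diagonal_mulVec_eq, mul_comm g,
      map_mul (src K σ)]
    simp [contractS'_tmul, antipode_tgt]
  | hL a b =>
    rw [comul_genL, mul_assoc,
      (sepIdem_comm_comulL K σ _ _).mul_right (sepIdem_comm_src K σ _) |>.eq,
      contractS'_mul_sepIdem]
    simp only [comulL, Finset.sum_mul, Algebra.TensorProduct.tmul_mul_tmul, mul_one, map_sum,
      contractS'_tmul, antipode_genL, ← src_mul_genL]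
    simp_rw [mul_assoc]
    rw [← Finset.mul_sum, sum_genL_genLinv, matRep_genL, Matrix.smul_mulVec, map_smul,
      mul_smul_comm, mul_one, shiftMat_mulVec]
  | hL' a b =>
    obtain ⟨g, rfl⟩ := shift_surjective K b f
    rw [comul_genLinv, mul_assoc,
      (sepIdem_comm_comulLinv K σ _ _).mul_right (sepIdem_comm_src K σ _) |>.eq,
      contractS'_mul_sepIdem]
    simp only [comulLinv, Finset.sum_mul, Algebra.TensorProduct.tmul_mul_tmul, mul_one, map_sum,
      contractS'_tmul, antipode_genLinv, ← src_mul_genLinv]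
    simp_rw [mul_assoc]
    rw [← Finset.mul_sum, sum_genLinv_genL_op K hF, matRep_genLinv, Matrix.smul_mulVec, map_smul,
      mul_smul_comm, mul_one]
    by_cases h : a = b
    · subst h
      rw [transpose_mulVec_shift]
    · simp [delta, h]
  | hadd a b ha hb =>
    rw [map_add, add_mul, map_add, ha, hb, map_add, Matrix.add_mulVec, map_add]
  | hmul a b ha hb =>
    rw [comul_mul, mul_assoc, contractS'_mul_of_eq_src K hF _ _ _ (hb f), ha, map_mul,
      Matrix.mulVec_mulVec]

/-- The weak Hopf algebra structure of `A_σ`. -/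
def frtWeakHopf : WeakHopfData K (FRTAlg K σ) (Q → K) where
  s := src K σ
  t := tgt K σ
  s_mul_t := src_tgt_comm K σ
  Δ := comul K σ
  Δ_mul := comul_mul K σ
  Δ_coassoc := comul_coassoc K σ
  Δ_s_mul := comul_src_mul K σ
  Δ_mul_s := comul_mul_src K σ
  Δ_t_mul := comul_tgt_mul K σ
  Δ_mul_t := comul_mul_tgt K σ
  balanced_left := tgt_mul_comul K σ
  balanced_right := comul_mul_tgt_left K σ
  Δ_one_left := by rw [comul_one]; exact sepIdem_sub_one_mem_left K σ
  Δ_one_right := by rw [comul_one]; exact sepIdem_sub_one_mem_right K σ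
  εL := counitL K hF.weight
  εL_one := counitL_one K hF.weight
  εL_s_mul := counitL_src_mul K hF.weight
  εL_t_mul := counitL_tgt_mul K hF.weight
  εL_mul_s := counitL_mul_src_counitL K hF.weight
  εL_mul_t := counitL_mul_tgt_counitL K hF.weight
  εR := counitR K hF.weight
  εR_one := counitR_one K hF.weight
  εR_mul_s := counitR_mul_src K hF.weight
  εR_mul_t := counitR_mul_tgt K hF.weight
  εR_s_mul := counitR_src_counitR_mul K hF.weight
  εR_t_mul := counitR_tgt_counitR_mul K hF.weight
  εL_left := contractLL_comul K hF.weight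
  εL_right := contractLR_comul K hF.weight
  εR_right := contractRR_comul K hF.weight
  εR_left := contractRL_comul K hF.weight
  S := antipode K hF
  S_t_mul f a := by rw [antipode_mul, antipode_tgt]
  S_mul_s f a := by rw [antipode_mul, antipode_src]
  S_left a := by
    have h := contractS_tgt_mul_comul K hF a 1
    rw [map_one, ← Algebra.TensorProduct.one_def, one_mul] at h
    exact h
  S_right a := by
    have h := contractS'_comul_mul_src K hF a 1
    rw [map_one, ← Algebra.TensorProduct.one_def, mul_one] at h
    exact h

end Antipode

/-! ### The Hopf algebroid of a face model -/

section Structure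

variable (K : Type*) [Field K] {Q : Type*} [Mul Q] [IsQuasigroup Q] [Fintype Q]
  {σ : Q → Q × Q → Q × Q} {F : Q → Q → Q → Q → Prop} (hF : IsFaceModel σ F)

/-- E and 1 have the same class, so the idempotent in the coproducts of generators disappears in the
quotient and leaves the prescribed formula. -/
lemma mk_left_sepIdem_mul (x : FRTAlg K σ ⊗[K] FRTAlg K σ) :
    (Submodule.Quotient.mk (sepIdem K σ * x) :
        BalTensor (frtWeakHopf K hF).ρL (frtWeakHopf K hF).τL) =
      Submodule.Quotient.mk x := by
  have h := (frtWeakHopf K hF).mk_mul_left (sepIdem K σ) 1 x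
    ((Submodule.Quotient.eq _).2 (sepIdem_sub_one_mem_left K σ))
  rwa [one_mul] at h

lemma mk_right_mul_sepIdem (x : FRTAlg K σ ⊗[K] FRTAlg K σ) :
    (Submodule.Quotient.mk (x * sepIdem K σ) :
        BalTensor (frtWeakHopf K hF).ρR (frtWeakHopf K hF).τR) =
      Submodule.Quotient.mk x := by
  have h := (frtWeakHopf K hF).mk_mul_right (sepIdem K σ) 1 x
    ((Submodule.Quotient.eq _).2 (sepIdem_sub_one_mem_right K σ))
  rwa [mul_one] at h

lemma left_comul_genL (a b : Q) :
    (frtWeakHopf K hF).hopfAlgebroid.left.comul (genL K σ a b) =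
      Submodule.Quotient.mk (∑ c, genL K σ a c ⊗ₜ[K] genL K σ c b) :=
  (congrArg Submodule.Quotient.mk (comul_genL K σ a b)).trans
    (mk_left_sepIdem_mul K hF (comulL K σ a b))

lemma right_comul_genL (a b : Q) :
    (frtWeakHopf K hF).hopfAlgebroid.right.comul (genL K σ a b) =
      Submodule.Quotient.mk (∑ c, genL K σ a c ⊗ₜ[K] genL K σ c b) :=
  (congrArg Submodule.Quotient.mk
    -- The right quotient absorbs E only on the right, so it is first commuted past the sum.
    ((comul_genL K σ a b).trans (sepIdem_comm_comulL K σ a b).eq)).trans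
    (mk_right_mul_sepIdem K hF (comulL K σ a b))

/-- For a face model, `A_σ` is a Hopf algebroid with involutive antipode. -/
theorem exists_hopfAlgebroid_of_isFaceModel (hF : IsFaceModel σ F) :
    ∃ H : HopfAlgebroid K (FRTAlgebra K σ) (Q → K) (Q → K),
      IsFRTStructure K σ H ∧ Function.Bijective H.antipode := by
  refine ⟨(frtWeakHopf K hF).hopfAlgebroid, ?_, ?_⟩
  · constructor
    · exact fun f => rfl
    · exact fun f => rfl
    · exact fun f => rfl
    · exact fun f => rfl
    · exact left_comul_genL K hF
    · exact right_comul_genL K hF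
    · intro a b
      refine (counitL_genL K hF.weight a b).trans ?_
      ext l
      simp
    · intro a b
      refine (counitR_genL K hF.weight a b).trans ?_
      ext l
      simp
    · exact antipode_genL K hF
  · exact Function.Involutive.bijective (antipode_antipode K hF)

end Structure

/-! ### Words in the maps s_x and the faces of the module -/

section Word

variable {R M : Type*} [Ring R] [AddCommGroup M] [Module R M]

lemma sPerm_apply (r : Rˣ) (x y : M) : sPerm r x y = (1 - (r : R)) • x + (r : R) • y := rfl

/-- The map s_x is y ↦ x + r(y - x), the homothety with centre x and ratio r, so composing at a
fixed centre multiplies ratios. Integer powers then only change the ratio. -/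
lemma sPerm_mul (r r' : Rˣ) (x : M) : sPerm (r * r') x = sPerm r x * sPerm r' x := by
  ext y
  simp only [Equiv.Perm.mul_apply, sPerm_apply, Units.val_mul, smul_add, smul_sub, smul_smul,
    sub_smul, one_smul]
  abel

lemma sPerm_zpow (r : Rˣ) (x : M) (i : ℤ) : sPerm r x ^ i = sPerm (r ^ i) x :=
  (map_zpow (MonoidHom.mk' (fun r : Rˣ => sPerm r x) fun r r' => sPerm_mul r r' x) r i).symm

lemma sum_Icc_add_two (f : ℕ → R) (n : ℕ) :
    ∑ j ∈ Finset.Icc 1 (n + 2), f j = f 1 + f 2 + ∑ j ∈ Finset.Icc 1 n, f (j + 2) := by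
  induction n with
  | zero => simp [Finset.sum_Icc_succ_top]
  | succ n ih =>
    rw [Finset.sum_Icc_succ_top (by omega), ih, Finset.sum_Icc_succ_top (by omega), add_assoc]

lemma phi_nil (r : Rˣ) : phi [] r = (1 : R) := by simp [phi]

lemma phi_singleton (i : ℤ) (r : Rˣ) : phi [i] r = (1 : R) := by simp [phi]

/-- Two letters are removed at a time: this preserves the signs, the parity of the length and the
roles of x and y in the word, so it matches the recursion for `word`. -/
lemma phi_cons_cons (i j : ℤ) (I : List ℤ) (r : Rˣ) :
    phi (i :: j :: I) r = (1 : R) - ((r ^ i : Rˣ) : R) + ((r ^ i : Rˣ) : R) * ((r ^ j : Rˣ) : R) *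
      phi I r := by
  have h : (if Even (i :: j :: I).length then (i :: j :: I).length
      else (i :: j :: I).length - 1) = (if Even I.length then I.length else I.length - 1) + 2 := by
    simp only [List.length_cons, Nat.even_add_one, not_not]
    split_ifs with h
    · rfl
    -- The tail has odd length here, hence is nonempty and the truncated subtraction is exact.
    · have : I.length ≠ 0 := fun e => h (by simp [e])
      omega
  rw [phi, h, sum_Icc_add_two, phi, mul_add, mul_one, Finset.mul_sum]
  have h' : ∀ n, (-1 : R) ^ (n + 2) * ((r ^ ((i :: j :: I).take (n + 2)).sum : Rˣ) : R) =
      ((r ^ i : Rˣ) : R) * ((r ^ j : Rˣ) : R) * ((-1) ^ n * ((r ^ (I.take n).sum : Rˣ) : R)) := by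
    intro n
    simp only [List.take_succ_cons, List.sum_cons, zpow_add, Units.val_mul, pow_add]
    rw [((Commute.neg_one_left
      (((r ^ i : Rˣ) : R) * ((r ^ j : Rˣ) : R))).pow_left n).symm.left_comm]
    simp [mul_assoc]
  simp_rw [h']
  simp
  abel

/-- A composite of homotheties is affine with ratio the product r^{ΣI} of the ratios, and the three
coefficients add up to 1. So a single further quantity is needed, and it is `phi I r`. -/
lemma word_sPerm_apply (r : Rˣ) (x y z : M) : ∀ I : List ℤ,
    word I (sPerm r x) (sPerm r y) z = (phi I r - ((r ^ I.sum : Rˣ) : R)) • x +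
      (1 - phi I r : R) • y + ((r ^ I.sum : Rˣ) : R) • z
  | [] => by simp [word, phi_nil]
  | [i] => by
    simp [word, phi_singleton, sPerm_zpow, sPerm_apply]
  | i :: j :: I => by
    rw [word, word, Equiv.Perm.mul_apply, Equiv.Perm.mul_apply, word_sPerm_apply r x y z I,
      sPerm_zpow, sPerm_zpow, sPerm_apply, sPerm_apply, phi_cons_cons]
    simp only [List.sum_cons, zpow_add, Units.val_mul, smul_add, smul_sub, smul_smul, sub_smul,
      add_smul, one_smul, mul_assoc]
    abel

lemma mu_eq (r : Rˣ) (I : List ℤ) (h : phi I r = (0 : R)) (a b c : M) :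
    mu r I a b c = a + ((r ^ I.sum : Rˣ) : R) • (c - b) := by
  rw [mu, eta, word_sPerm_apply, h, zero_sub, sub_zero, one_smul, neg_smul, smul_sub]
  abel

/-- The face equation is affine with unit coefficients, so it can be solved for each corner. Solving
for the second and third corners uses the inverse of r^{ΣI}. -/
lemma isFaceModel_sigma {Q : Type*} [Mul Q] [IsQuasigroup Q] (π : Q ≃ M) (r : Rˣ) (I : List ℤ)
    (h : phi I r = (0 : R)) :
    IsFaceModel (sigma π (mu r I)) fun a b c d =>
      π d = π a + ((r ^ I.sum : Rˣ) : R) • (π c - π b) where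
  sigma_iff l x y a c := by
    -- The second component of σ forces lc = h, the fourth corner; the first then states that a
    -- completes the path from h to (ly)x.
    rw [sigma, Prod.mk.injEq, eq_comm (b := a), eq_comm (b := c), eq_ldiv_iff, eq_ldiv_iff,
      mu_eq r I h, Equiv.eq_symm_apply]
    constructor
    · rintro ⟨h₁, h₂⟩
      rw [← h₂, Equiv.symm_apply_apply] at h₁
      exact ⟨h₂, h₁⟩
    · rintro ⟨h₁, h₂⟩
      rw [← h₁, Equiv.symm_apply_apply]
      exact ⟨h₂, rfl⟩
  existsUnique₁ b c d := by
    refine ⟨π.symm (π d - ((r ^ I.sum : Rˣ) : R) • (π c - π b)), by simp, fun a ha => ?_⟩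
    rw [Equiv.eq_symm_apply, ha, add_sub_cancel_right]
  existsUnique₂ a c d := by
    refine ⟨π.symm (π c - (((r ^ I.sum)⁻¹ : Rˣ) : R) • (π d - π a)), ?_, fun b hb => ?_⟩
    · simp [smul_smul]
    · change _ = _ at hb
      rw [Equiv.eq_symm_apply, hb, add_sub_cancel_left, smul_smul, Units.inv_mul, one_smul,
        sub_sub_cancel]
  existsUnique₃ a b d := by
    refine ⟨π.symm (π b + (((r ^ I.sum)⁻¹ : Rˣ) : R) • (π d - π a)), ?_, fun c hc => ?_⟩
    · simp [smul_smul]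
    · change _ = _ at hc
      rw [Equiv.eq_symm_apply, hc, add_sub_cancel_left, smul_smul, Units.inv_mul, one_smul,
        add_sub_cancel]
  existsUnique₄ a b c := by
    refine ⟨π.symm (π a + ((r ^ I.sum : Rˣ) : R) • (π c - π b)), by simp, fun d hd => ?_⟩
    rw [Equiv.eq_symm_apply, hd]

end Word

end SSetHopf

end

theorem mainTheorem3 {K : Type*} [Field K]
    {R : Type*} [Ring R] [Nontrivial R]
    {M : Type*} [AddCommGroup M] [Module R M] [Finite M] [Nontrivial M]
    {Q : Type*} [Mul Q] [SSetHopf.IsQuasigroup Q] [Fintype Q] (π : Q ≃ M)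
    (r : Rˣ) (I : List ℤ) (hI : 2 ≤ I.length) (hr : SSetHopf.phi I r = 0) :
    ∃ H : SSetHopf.HopfAlgebroid K
        (SSetHopf.FRTAlgebra K (SSetHopf.sigma π (SSetHopf.mu r I))) (Q → K) (Q → K),
      SSetHopf.IsFRTStructure K (SSetHopf.sigma π (SSetHopf.mu r I)) H ∧
        Function.Bijective H.antipode :=
  SSetHopf.exists_hopfAlgebroid_of_isFaceModel K (SSetHopf.isFaceModel_sigma π r I hr)
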